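/- Let $K$ be a quadratic field with non-trivial automorphism $\sigma$ and algebraic closure $\overline{\mathbb Q}$. An elliptic curve $E/K$ is called a $\mathbb Q$-curve of degree $d$ if there is an isogeny $E\to E^\sigma$ over $\overline{\mathbb Q}$ with cyclic kernel of order $d$. For $n=dm$ with $(d,m)=1$, the non-cuspidal $\overline{\mathbb Q}$-points of $X_0(n)$ are the isomorphism classes of triples $(E,C_d,C_m)$, where $E/\overline{\mathbb Q}$ is an elliptic curve and $C_d$, $C_m$ are cyclic subgroups of orders $d$ and $m$ (equivalently, of pairs $(E,C)$ with $C=C_d+C_m$ cyclic of order $n$), and the Atkin–Lehner involution $w_d$ sends $(E,C_d,C_m)$ to $(E/C_d,\,E[d]/C_d,\,(C_m+C_d)/C_d)$. The non-cuspidal rational points on $X_0(n)/w_d$ are the $\operatorname{Gal}(\overline{\mathbb Q}/\mathbb Q)$-invariant orbits $\{x,w_d(x)\}$ of $w_d$ on these points. An elliptic curve $F$ corresponds to such a rational point if $j(F)$ is the $j$-invariant of the elliptic curve underlying $x$ or of the one underlying $w_d(x)$. Write $X_0^+(n)=X_0(n)/w_n$. Proposition. Let $d\ge 1$ be an integer and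 $m$ a prime with $(m,d)=1$. Let $E$ be an elliptic curve over a quadratic field $K$ without complex multiplication (that is, $\operatorname{End}_{\overline{\mathbb Q}}(E)=\mathbb Z$) which is a $\mathbb Q$-curve of degree $d$ and which has an $m$-isogeny over $K$, that is, there is an isogeny $E\to E'$ defined over $K$ with kernel cyclic of order $m$. Then either $E$ corresponds to a rational point on $X_0(dm)/w_d$, or $E$ is isogenous over $K$ to an elliptic curve $E_1/K$ which corresponds to a rational point on $X_0^+(dm^2)$ (the two cases are not claimed to exclude each other). -/

import Mathlib

noncomputable section

namespace QCurve

open WeierstrassCurve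

/-- The group of points of a Weierstrass curve over a field `Ω`. In the sequel `Ω` is an algebraic
closure, so these are the geometric points. -/
abbrev Pt {Ω : Type*} [Field Ω] (E : WeierstrassCurve Ω) : Type _ :=
  WeierstrassCurve.Affine.Point E.toAffine

/-- The `n`-torsion subgroup `A[n]`. -/
def torsion (A : Type*) [AddCommGroup A] (n : ℕ) : AddSubgroup A :=
  (nsmulAddMonoidHom (α := A) n).ker

/-! ### Isogenies -/

/-- The map `φ` is `(x, y) ↦ (u(x, y) / w(x, y), v(x, y) / w(x, y))` at all but finitely many
points. -/
def GivenBy {Ω : Type*} [Field Ω] {E₁ E₂ : WeierstrassCurve Ω} (φ : Pt E₁ → Pt E₂)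
    (u v w : Polynomial (Polynomial Ω)) : Prop :=
  {P : Pt E₁ | ¬ ∃ (x y : Ω) (h : E₁.toAffine.Nonsingular x y)
    (h' : E₂.toAffine.Nonsingular (u.evalEval x y / w.evalEval x y)
      (v.evalEval x y / w.evalEval x y)),
    P = .some x y h ∧ w.evalEval x y ≠ 0 ∧ φ P = .some _ _ h'}.Finite

/-- An isogeny between elliptic curves `E₁`, `E₂`, as a homomorphism on the points over the
algebraically closed field `Ω`: it is surjective, has finite kernel and is given by rational
functions. It is defined over the subfield `k` (over which `E₁` and `E₂` are to be defined) if the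
rational functions can be taken with coefficients in `k`. For isogenies over `Ω` take `k = Ω`.
In characteristic zero the degree is the order of the kernel. -/
structure IsIsogeny (k : Type*) {Ω : Type*} [Field k] [Field Ω] [DecidableEq Ω] [Algebra k Ω]
    {E₁ E₂ : WeierstrassCurve Ω} (φ : Pt E₁ →+ Pt E₂) : Prop where
  surjective : Function.Surjective φ
  finite_ker : Finite φ.ker
  rational : ∃ u v w : Polynomial (Polynomial k), GivenBy φ
    (u.map (Polynomial.mapRingHom (algebraMap k Ω)))
    (v.map (Polynomial.mapRingHom (algebraMap k Ω)))
    (w.map (Polynomial.mapRingHom (algebraMap k Ω)))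

/-- The kernel of `φ` is cyclic of order `n`. -/
def HasCyclicKernel {A B : Type*} [AddCommGroup A] [AddCommGroup B] (φ : A →+ B) (n : ℕ) : Prop :=
  IsAddCyclic φ.ker ∧ Nat.card φ.ker = n

/-- `E` has complex multiplication: some isogeny `E → E` over `Ω` is not the multiplication by an
integer. -/
def HasCM {Ω : Type*} [Field Ω] [DecidableEq Ω] (E : WeierstrassCurve Ω) : Prop :=
  ∃ φ : Pt E →+ Pt E, IsIsogeny Ω φ ∧ ∀ n : ℤ, φ ≠ n • AddMonoidHom.id (Pt E)

/-! ### Conjugation by field automorphisms -/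

section Conj

variable {Ω : Type*} [Field Ω]

/-- The conjugate curve `E^g`: `g` is applied to the coefficients. -/
abbrev conj (g : Ω ≃+* Ω) (E : WeierstrassCurve Ω) : WeierstrassCurve Ω :=
  E.map (g : Ω →+* Ω)

lemma conj_nonsingular (g : Ω ≃+* Ω) (E : WeierstrassCurve Ω) (x y : Ω) :
    (conj g E).toAffine.Nonsingular (g x) (g y) ↔ E.toAffine.Nonsingular x y :=
  Affine.map_nonsingular E.toAffine (f := (g : Ω →+* Ω)) g.injective x y

variable [DecidableEq Ω]

/-- The isomorphism `E(Ω) → E^g(Ω)`, `(x, y) ↦ (g x, g y)`. -/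
def conjPt (g : Ω ≃+* Ω) (E : WeierstrassCurve Ω) : Pt E ≃+ Pt (conj g E) where
  toFun P := match P with
    | .zero => .zero
    | .some x y h => .some (g x) (g y) ((conj_nonsingular g E x y).mpr h)
  invFun P := match P with
    | .zero => .zero
    | .some x y h => .some (g.symm x) (g.symm y)
        ((conj_nonsingular g E _ _).mp (by simpa using h))
  left_inv := by rintro (_ | ⟨x, y, h⟩) <;> simp
  right_inv := by rintro (_ | ⟨x, y, h⟩) <;> simp
  map_add' := by
    rintro (_ | ⟨x₁, y₁, h₁⟩) (_ | ⟨x₂, y₂, h₂⟩)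
    any_goals rfl
    have hn : (conj g E).toAffine.negY (g x₂) (g y₂) = g (E.toAffine.negY x₂ y₂) :=
      Affine.map_negY (W' := E.toAffine) (g : Ω →+* Ω) x₂ y₂
    by_cases hxy : x₁ = x₂ ∧ y₁ = E.toAffine.negY x₂ y₂
    · rw [Affine.Point.add_of_Y_eq hxy.left hxy.right]
      exact (Affine.Point.add_of_Y_eq (congrArg g hxy.1) (by rw [hn, hxy.2])).symm
    · have hxy' : ¬ (g x₁ = g x₂ ∧ g y₁ = (conj g E).toAffine.negY (g x₂) (g y₂)) := by
        rw [hn]; exact fun h => hxy ⟨g.injective h.1, g.injective h.2⟩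
      have hs := Affine.map_slope (W := E.toAffine) (g : Ω →+* Ω) x₁ x₂ y₁ y₂
      have hX := Affine.map_addX (W' := E.toAffine) (g : Ω →+* Ω) x₁ x₂
        (E.toAffine.slope x₁ x₂ y₁ y₂)
      have hY := Affine.map_addY (W' := E.toAffine) (g : Ω →+* Ω) x₁ y₁ x₂
        (E.toAffine.slope x₁ x₂ y₁ y₂)
      rw [← hs] at hX hY
      rw [Affine.Point.add_some hxy]
      refine Eq.trans ?_ (Affine.Point.add_some hxy').symm
      simp only [Affine.Point.some.injEq]
      exact ⟨hX.symm, hY.symm⟩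

/-- The conjugate `φ^g : E₁^g → E₂^g` of a homomorphism `φ : E₁ → E₂`. -/
def conjHom (g : Ω ≃+* Ω) {E₁ E₂ : WeierstrassCurve Ω} (φ : Pt E₁ →+ Pt E₂) :
    Pt (conj g E₁) →+ Pt (conj g E₂) :=
  (conjPt g E₂).toAddMonoidHom.comp (φ.comp (conjPt g E₁).symm.toAddMonoidHom)

lemma conjHom_conjPt (g : Ω ≃+* Ω) {E₁ E₂ : WeierstrassCurve Ω} (φ : Pt E₁ →+ Pt E₂) (P : Pt E₁) :
    conjHom g φ (conjPt g E₁ P) = conjPt g E₂ (φ P) := by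
  simp [conjHom]

lemma conjHom_ker (g : Ω ≃+* Ω) {E₁ E₂ : WeierstrassCurve Ω} (φ : Pt E₁ →+ Pt E₂) :
    (conjHom g φ).ker = φ.ker.map (conjPt g E₁).toAddMonoidHom := by
  ext P
  obtain ⟨P, rfl⟩ := (conjPt g E₁).surjective P
  simp [AddMonoidHom.mem_ker, conjHom_conjPt]

lemma conjHom_map (g : Ω ≃+* Ω) {E₁ E₂ : WeierstrassCurve Ω} (φ : Pt E₁ →+ Pt E₂)
    (A : AddSubgroup (Pt E₁)) :
    (A.map φ).map (conjPt g E₂).toAddMonoidHom =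
      (A.map (conjPt g E₁).toAddMonoidHom).map (conjHom g φ) := by
  rw [AddSubgroup.map_map, AddSubgroup.map_map]
  congr 1
  ext P
  simp [conjHom_conjPt]

lemma IsIsogeny.conj (g : Ω ≃+* Ω) {E₁ E₂ : WeierstrassCurve Ω} {φ : Pt E₁ →+ Pt E₂}
    (hφ : IsIsogeny Ω φ) : IsIsogeny Ω (conjHom g φ) where
  surjective Q := by
    obtain ⟨Q, rfl⟩ := (conjPt g E₂).surjective Q
    obtain ⟨P, rfl⟩ := hφ.surjective Q
    exact ⟨conjPt g E₁ P, conjHom_conjPt g φ P⟩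
  finite_ker := by
    have := hφ.finite_ker
    rw [conjHom_ker]
    exact Set.Finite.image _ (Set.toFinite (φ.ker : Set (Pt E₁)))
  rational := by
    obtain ⟨u, v, w, h⟩ := hφ.rational
    refine ⟨u.map (Polynomial.mapRingHom (g : Ω →+* Ω)), v.map (Polynomial.mapRingHom (g : Ω →+* Ω)),
      w.map (Polynomial.mapRingHom (g : Ω →+* Ω)), ?_⟩
    simp only [Algebra.algebraMap_self, Polynomial.mapRingHom_id, Polynomial.map_id, GivenBy]
      at h ⊢
    refine (h.image (conjPt g E₁)).subset fun Q hQ => ?_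
    obtain ⟨P, rfl⟩ := (conjPt g E₁).surjective Q
    refine ⟨P, fun hP => hQ ?_, rfl⟩
    obtain ⟨x, y, h₁, h₂, rfl, hw, hP⟩ := hP
    have ev (p : Polynomial (Polynomial Ω)) : (p.map (Polynomial.mapRingHom (g : Ω →+* Ω))).evalEval (g x) (g y) =
        g (p.evalEval x y) := Polynomial.map_mapRingHom_evalEval (g : Ω →+* Ω) p x y
    refine ⟨g x, g y, (conj_nonsingular g E₁ x y).mpr h₁, ?_, rfl, ?_, ?_⟩
    · simp only [ev, ← map_div₀]
      exact (conj_nonsingular g E₂ _ _).mpr h₂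
    · simpa [ev] using hw
    · rw [conjHom_conjPt, hP]
      change Affine.Point.some _ _ _ = _
      simp [ev]

lemma torsion_map_equiv {A B : Type*} [AddCommGroup A] [AddCommGroup B] (e : A ≃+ B) (n : ℕ) :
    (torsion A n).map e.toAddMonoidHom = torsion B n := by
  ext P
  obtain ⟨P, rfl⟩ := e.surjective P
  simp [torsion, AddMonoidHom.mem_ker, ← map_nsmul]

end Conj

/-! ### The modular curves `Y₀(n)` and their Atkin–Lehner quotients -/

section Modular

variable {Ω : Type*} [Field Ω]

/-- The affine substitution `x = u²X + r`, `y = u³Y + u²sX + t` takes the curve `V • E` with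
coordinates `X, Y` isomorphically to `E`. -/
lemma variableChange_nonsingular (V : VariableChange Ω) (E : WeierstrassCurve Ω) [E.IsElliptic]
    (x y : Ω) : (V • E).toAffine.Nonsingular x y ↔ E.toAffine.Nonsingular
      (V.u ^ 2 * x + V.r) (V.u ^ 3 * y + V.u ^ 2 * V.s * x + V.t) := by
  rw [← Affine.equation_iff_nonsingular, ← Affine.equation_iff_nonsingular, Affine.equation_iff',
    Affine.equation_iff']
  have hu : (V.u : Ω) ≠ 0 := V.u.ne_zero
  simp only [variableChange_def, Units.val_inv_eq_inv_val]
  rw [← mul_right_inj' (pow_ne_zero 6 hu), mul_zero]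
  refine Eq.congr ?_ rfl
  field_simp
  ring

variable [DecidableEq Ω]

variable (Ω) in
/-- A pair `(E, C)`: an elliptic curve over `Ω` with a cyclic subgroup of order `n`. For `n = dm`
with `(d, m) = 1` it is the same as a triple `(E, C_d, C_m)`, where `C_d = C[d]`, `C_m = C[m]`. -/
structure CyclicPair (n : ℕ) where
  E : WeierstrassCurve Ω
  elliptic : E.IsElliptic
  C : AddSubgroup (Pt E)
  cyclic : IsAddCyclic C
  card : Nat.card C = n

attribute [instance] CyclicPair.elliptic

/-- Two pairs are isomorphic if an isomorphism of elliptic curves (that is, a change of Weierstrass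
coordinates) matches the subgroups. -/
def CyclicPair.Iso {n : ℕ} (p q : CyclicPair Ω n) : Prop :=
  ∃ V : VariableChange Ω, V • p.E = q.E ∧
    ∀ (x y : Ω) (h : q.E.toAffine.Nonsingular x y) (h' : p.E.toAffine.Nonsingular
      (V.u ^ 2 * x + V.r) (V.u ^ 3 * y + V.u ^ 2 * V.s * x + V.t)),
      (Affine.Point.some x y h ∈ q.C ↔ Affine.Point.some _ _ h' ∈ p.C)

lemma mem_congr {E : WeierstrassCurve Ω} (C : AddSubgroup (Pt E)) {x y x' y' : Ω}
    (hx : x = x') (hy : y = y') (h : E.toAffine.Nonsingular x y)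
    (h' : E.toAffine.Nonsingular x' y') :
    (Affine.Point.some x y h : Pt E) ∈ C ↔ (Affine.Point.some x' y' h' : Pt E) ∈ C := by
  subst hx hy; rfl

lemma CyclicPair.Iso.refl {n : ℕ} (p : CyclicPair Ω n) : p.Iso p :=
  ⟨1, one_smul _ _, fun x y h h' => mem_congr _ (by simp [VariableChange.one_def])
    (by simp [VariableChange.one_def]) _ _⟩

lemma CyclicPair.Iso.symm {n : ℕ} {p q : CyclicPair Ω n} (h : p.Iso q) : q.Iso p := by
  obtain ⟨V, hV, H⟩ := h
  refine ⟨V⁻¹, by rw [← hV, inv_smul_smul], fun x y h h' => ?_⟩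
  have hu : (V.u : Ω) ≠ 0 := V.u.ne_zero
  have h'' := h'
  rw [show q.E = V • p.E from hV.symm, variableChange_nonsingular] at h''
  rw [H _ _ h' h'']
  refine mem_congr _ ?_ ?_ _ _ <;> simp [VariableChange.inv_def] <;> field_simp <;> ring

lemma CyclicPair.Iso.trans {n : ℕ} {p q r : CyclicPair Ω n} (h₁ : p.Iso q) (h₂ : q.Iso r) :
    p.Iso r := by
  obtain ⟨V, hV, H⟩ := h₁
  obtain ⟨W, hW, H'⟩ := h₂
  refine ⟨W * V, by rw [mul_smul, hV, hW], fun x y h h' => ?_⟩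
  have h₁ := h
  rw [show r.E = W • q.E from hW.symm, variableChange_nonsingular] at h₁
  have h₂ := h₁
  rw [show q.E = V • p.E from hV.symm, variableChange_nonsingular] at h₂
  rw [H' _ _ h h₁, H _ _ h₁ h₂]
  refine mem_congr _ ?_ ?_ _ _ <;> simp [VariableChange.mul_def] <;> ring

variable (Ω) in
/-- Isomorphism of pairs `(E, C)`. -/
instance CyclicPair.setoid (n : ℕ) : Setoid (CyclicPair Ω n) :=
  ⟨CyclicPair.Iso, CyclicPair.Iso.refl, CyclicPair.Iso.symm, CyclicPair.Iso.trans⟩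

variable (Ω) in
/-- The points of `Y₀(n)` over the algebraically closed field `Ω`: isomorphism classes of pairs
`(E, C)`. -/
def Y0 (n : ℕ) : Type _ := Quotient (CyclicPair.setoid Ω n)

/-- The `j`-invariant of the point `(E, C)`. -/
def Y0.j {n : ℕ} : Y0 Ω n → Ω :=
  Quotient.lift (fun p => p.E.j) (by
    rintro ⟨E, hE, C, _, _⟩ ⟨E', hE', C', _, _⟩ ⟨V, hV, _⟩
    dsimp only at hV ⊢
    subst hV
    exact (variableChange_j E V).symm)

/-- The conjugate pair `(E^g, C^g)`. -/
def CyclicPair.conj {n : ℕ} (g : Ω ≃+* Ω) (p : CyclicPair Ω n) : CyclicPair Ω n where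
  E := QCurve.conj g p.E
  elliptic := inferInstance
  C := p.C.map (conjPt g p.E).toAddMonoidHom
  cyclic := by
    have := p.cyclic
    exact isAddCyclic_of_surjective ((conjPt g p.E).addSubgroupMap p.C)
      ((conjPt g p.E).addSubgroupMap p.C).surjective
  card := (Nat.card_congr ((conjPt g p.E).addSubgroupMap p.C).toEquiv).symm.trans p.card

lemma CyclicPair.Iso.conj {n : ℕ} (g : Ω ≃+* Ω) {p q : CyclicPair Ω n} (h : p.Iso q) :
    (p.conj g).Iso (q.conj g) := by
  obtain ⟨V, hV, H⟩ := h
  refine ⟨V.map (g : Ω →+* Ω), ?_, fun x y h h' => ?_⟩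
  · change V.map (g : Ω →+* Ω) • p.E.map (g : Ω →+* Ω) = q.E.map (g : Ω →+* Ω)
    rw [map_variableChange, hV]
  · obtain ⟨x, rfl⟩ := g.surjective x
    obtain ⟨y, rfl⟩ := g.surjective y
    have h₁ := (conj_nonsingular g q.E x y).mp h
    have h₂ := h₁
    rw [show q.E = V • p.E from hV.symm, variableChange_nonsingular] at h₂
    have key (r : CyclicPair Ω n) (P : Pt r.E) : conjPt g r.E P ∈ (r.conj g).C ↔ P ∈ r.C :=
      AddSubgroup.mem_map_equiv.trans (by simp)
    refine (key q (.some x y h₁)).trans ((H x y h₁ h₂).trans ((key p (.some _ _ h₂)).symm.trans ?_))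
    refine mem_congr _ ?_ ?_ _ h' <;> simp [VariableChange.map]

/-- The action of field automorphisms of `Ω` on the points of `Y₀(n)`. -/
def Y0.conj {n : ℕ} (g : Ω ≃+* Ω) : Y0 Ω n → Y0 Ω n :=
  Quotient.map (CyclicPair.conj g) fun _ _ h => CyclicPair.Iso.conj g h

/-- There is an isogeny `μ : E₁ → E₂` with kernel `C₁[d]` such that `C₂ = μ(E₁[d]) + μ(C₁[m])`. -/
def IsQuotientBy (d m : ℕ) {E₁ E₂ : WeierstrassCurve Ω} (C₁ : AddSubgroup (Pt E₁))
    (C₂ : AddSubgroup (Pt E₂)) : Prop :=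
  ∃ μ : Pt E₁ →+ Pt E₂, IsIsogeny Ω μ ∧ μ.ker = C₁ ⊓ torsion (Pt E₁) d ∧
    C₂ = (torsion (Pt E₁) d).map μ ⊔ (C₁ ⊓ torsion (Pt E₁) m).map μ

lemma IsQuotientBy.conj {d m : ℕ} (g : Ω ≃+* Ω) {E₁ E₂ : WeierstrassCurve Ω}
    {C₁ : AddSubgroup (Pt E₁)} {C₂ : AddSubgroup (Pt E₂)} (h : IsQuotientBy d m C₁ C₂) :
    IsQuotientBy d m (C₁.map (conjPt g E₁).toAddMonoidHom)
      (C₂.map (conjPt g E₂).toAddMonoidHom) := by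
  obtain ⟨μ, hμ, hk, hC⟩ := h
  have hinf (k : ℕ) : (C₁ ⊓ torsion (Pt E₁) k).map (conjPt g E₁).toAddMonoidHom =
      C₁.map (conjPt g E₁).toAddMonoidHom ⊓ torsion (Pt (QCurve.conj g E₁)) k := by
    rw [AddSubgroup.map_inf _ _ _ (conjPt g E₁).injective, torsion_map_equiv]
  refine ⟨conjHom g μ, hμ.conj g, ?_, ?_⟩
  · rw [conjHom_ker, hk, hinf]
  · rw [hC, AddSubgroup.map_sup, conjHom_map, conjHom_map, torsion_map_equiv, hinf]

/-- The graph of the Atkin–Lehner involution `w_d` on pairs, where `d ∣ n` and `(d, n/d) = 1`: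
with `m = n/d`, `C_d = C[d]` and `C_m = C[m]` for `p = (E, C)`, the pair `q` is isomorphic to
`(E/C_d, E[d]/C_d + (C_m + C_d)/C_d)`. -/
def AtkinLehner {n : ℕ} (d : ℕ) (p q : CyclicPair Ω n) : Prop :=
  IsQuotientBy d (n / d) p.C q.C

lemma AtkinLehner.conj {n d : ℕ} (g : Ω ≃+* Ω) {p q : CyclicPair Ω n} (h : AtkinLehner d p q) :
    AtkinLehner d (p.conj g) (q.conj g) :=
  IsQuotientBy.conj g h

variable (Ω) in
/-- The non-cuspidal points over `Ω` of `X₀(n)/w_d`, where `d ∣ n` and `(d, n/d) = 1`: the quotient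
of the points of `Y₀(n)` by `w_d`. -/
def Y0Quot (n d : ℕ) : Type _ :=
  Quot fun x y : Y0 Ω n => ∃ p q : CyclicPair Ω n,
    x = Quotient.mk _ p ∧ y = Quotient.mk _ q ∧ AtkinLehner d p q

/-- The quotient map `Y₀(n) → Y₀(n)/w_d` on points. -/
def Y0Quot.mk {n : ℕ} (d : ℕ) (x : Y0 Ω n) : Y0Quot Ω n d := Quot.mk _ x

/-- The action of field automorphisms of `Ω` on the points of `Y₀(n)/w_d`. -/
def Y0Quot.conj {n d : ℕ} (g : Ω ≃+* Ω) : Y0Quot Ω n d → Y0Quot Ω n d :=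
  Quot.map (Y0.conj g) (by
    rintro _ _ ⟨p, q, rfl, rfl, h⟩
    exact ⟨p.conj g, q.conj g, rfl, rfl, h.conj g⟩)

/-- The point of `Y₀(n)/w_d` is rational over `ℚ`, that is invariant under the Galois group of
`Ω/ℚ`; here `Ω` is an algebraic closure of `ℚ`. -/
def Y0Quot.IsRational [Algebra ℚ Ω] {n d : ℕ} (z : Y0Quot Ω n d) : Prop :=
  ∀ g : Ω ≃ₐ[ℚ] Ω, z.conj (g : Ω ≃+* Ω) = z

/-- The elliptic curve `F` corresponds to a rational point on `X₀(n)/w_d`: for some non-cuspidal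
rational point `{x, w_d x}` of it, `j(F) = j(x)` or `j(F) = j(w_d x)`. -/
def Corresponds [Algebra ℚ Ω] (F : WeierstrassCurve Ω) [F.IsElliptic] (n d : ℕ) : Prop :=
  ∃ z : Y0Quot Ω n d, z.IsRational ∧ ∃ x : Y0 Ω n, Y0Quot.mk d x = z ∧ x.j = F.j

end Modular

/-! ### Elliptic curves over a number field -/

section Field

variable {K : Type*} [Field K]

/-- The base change of `E` to the algebraic closure. -/
abbrev geom (E : WeierstrassCurve K) : WeierstrassCurve (AlgebraicClosure K) :=
  E.map (algebraMap K (AlgebraicClosure K))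

variable [DecidableEq (AlgebraicClosure K)]

/-- `E` is isogenous over `K` to `E'`. -/
def IsogenousOver (E E' : WeierstrassCurve K) : Prop :=
  ∃ φ : Pt (geom E) →+ Pt (geom E'), IsIsogeny K φ

/-- `E` has an `m`-isogeny over `K`: an isogeny defined over `K` with cyclic kernel of order `m`. -/
def HasIsogenyOfDegree (E : WeierstrassCurve K) (m : ℕ) : Prop :=
  ∃ E' : WeierstrassCurve K, E'.IsElliptic ∧
    ∃ φ : Pt (geom E) →+ Pt (geom E'), IsIsogeny K φ ∧ HasCyclicKernel φ m

/-- `E` over the quadratic field `K` is a `ℚ`-curve of degree `d`: there is a cyclic isogeny of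
degree `d` over the algebraic closure from `E` to its conjugate `E^σ`, where `σ` is the non-trivial
automorphism of `K`. -/
def IsQCurveOfDegree [Algebra ℚ K] (E : WeierstrassCurve K) (d : ℕ) : Prop :=
  ∃ σ : K ≃ₐ[ℚ] K, σ ≠ 1 ∧ ∃ μ : Pt (geom E) →+ Pt (geom (E.map (σ : K →+* K))),
    IsIsogeny (AlgebraicClosure K) μ ∧ HasCyclicKernel μ d

end Field

end QCurve

end

/-!
For `E` without complex multiplication, two isogenies from `E` to the same curve with kernels of the
same order differ by a sign. Hence the kernel of the given isogeny `μ : E → E^σ` of degree `d` is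
fixed by every automorphism over `K`, and every `g` over `σ` carries it to `μ(E[d])`: the pair
`(E, ker μ)` is fixed by the Galois group up to `w_d`. If every such `g` also carries the kernel of
the `m`-isogeny `φ : E → E'` to its image under `μ`, then the same holds for `(E, ker μ + ker φ)`,
and this pair gives the rational point. Otherwise some `ρ` over `σ` carries `ker φ` to another
subgroup of order `m` of `E^σ`. The composite `φ^ρ ∘ μ ∘ φ̂ : E' → E → E^σ → E'^σ` is then cyclic of
degree `d * m ^ 2`, so `E'` is a `ℚ`-curve of that degree, and the first observation applies to it.

The dual isogeny `φ̂` is obtained by descending multiplication by `#ker φ` along `φ`, which requires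
`#E[n] = n ^ 2`.
-/

namespace QCurve

open WeierstrassCurve Polynomial Filter

section FiniteKernel

lemma eventually_forall_fiber {α β : Type*} (f : α → β) {p : α → Prop}
    (h : ∀ᶠ a in cofinite, p a) : ∀ᶠ b in cofinite, ∀ a, f a = b → p a := by
  refine (Set.Finite.image f h).subset fun b hb => ?_
  obtain ⟨a, hab, ha⟩ : ∃ a, f a = b ∧ ¬ p a := by
    simpa only [Set.mem_compl_iff, Set.mem_ofPred_eq, not_forall, exists_prop] using hb
  exact ⟨a, ha, hab⟩

variable {A B D : Type*} [AddCommGroup A] [AddCommGroup B] [AddCommGroup D]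

lemma preimage_singleton_map (φ : A →+ B) (a : A) : φ ⁻¹' {φ a} = (a + ·) '' (φ.ker : Set A) := by
  ext c
  rw [Set.image_add_left, Set.mem_preimage, Set.mem_preimage, SetLike.mem_coe,
    AddMonoidHom.mem_ker, map_add, map_neg, neg_add_eq_zero, Set.mem_singleton_iff, eq_comm]

lemma ncard_fiber (φ : A →+ B) (a : A) : (φ ⁻¹' {φ a}).ncard = Nat.card φ.ker := by
  rw [preimage_singleton_map, Set.ncard_image_of_injective _ (add_right_injective a),
    ← Nat.card_coe_set_eq, SetLike.coe_sort_coe]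

lemma tendsto_cofinite_of_finite_ker {φ : A →+ B} (h : Finite φ.ker) :
    Tendsto φ cofinite cofinite := by
  refine Tendsto.cofinite_of_finite_preimage_singleton fun b => ?_
  by_cases hb : b ∈ Set.range φ
  · obtain ⟨a, rfl⟩ := hb
    rw [preimage_singleton_map]
    exact (Set.toFinite (φ.ker : Set A)).image _
  · rw [Set.preimage_singleton_eq_empty.mpr hb]
    exact Set.finite_empty

lemma eventually_map_ne {φ : A →+ B} (h : Finite φ.ker) (b : B) : ∀ᶠ a in cofinite, φ a ≠ b :=
  (tendsto_cofinite_of_finite_ker h).eventually (eventually_cofinite_ne b)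

lemma finite_ker_comp {ψ : B →+ D} {φ : A →+ B} (hψ : Finite ψ.ker) (hφ : Finite φ.ker) :
    Finite (ψ.comp φ).ker := by
  have h : ∀ᶠ a in cofinite, ψ (φ a) ≠ 0 :=
    (tendsto_cofinite_of_finite_ker hφ).eventually (eventually_map_ne hψ 0)
  exact (eventually_cofinite.mp h).subset fun a ha => by simpa using ha

lemma card_ker_comp {ψ : B →+ D} {φ : A →+ B} (hφ : Function.Surjective φ) :
    Nat.card (ψ.comp φ).ker = Nat.card φ.ker * Nat.card ψ.ker := by
  have hle : φ.ker ≤ (ψ.comp φ).ker := fun a ha => by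
    rw [AddMonoidHom.mem_ker] at ha
    simp [ha]
  have hmap : (ψ.comp φ).ker.map φ = ψ.ker := by
    rw [← AddMonoidHom.comap_ker, AddSubgroup.map_comap_eq_self_of_surjective hφ]
  rw [← AddSubgroup.relIndex_bot_left, ← AddSubgroup.relIndex_mul_relIndex _ _ _ bot_le hle,
    AddSubgroup.relIndex_bot_left, AddSubgroup.relIndex_ker, hmap]

lemma addSubgroup_eq_top_of_eventually_mem [Infinite A] {H : AddSubgroup A}
    (h : ∀ᶠ a in cofinite, a ∈ H) : H = ⊤ := by
  refine (AddSubgroup.eq_top_iff' H).mpr fun a => ?_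
  have hsub : ∀ᶠ b in cofinite, a - b ∈ H := sub_right_injective.tendsto_cofinite.eventually h
  obtain ⟨b, hb, hab⟩ := (h.and hsub).exists
  simpa using H.add_mem hab hb

lemma addMonoidHom_eq_of_eventually_eq [Infinite A] {φ ψ : A →+ B}
    (h : ∀ᶠ a in cofinite, φ a = ψ a) : φ = ψ := by
  have htop : φ.eqLocus ψ = ⊤ := addSubgroup_eq_top_of_eventually_mem h
  exact AddMonoidHom.eq_of_eqOn_top fun a _ => (AddSubgroup.eq_top_iff' _).mp htop a

end FiniteKernel

section PolynomialFibres

lemma eventually_eval_ne_zero {R : Type*} [CommRing R] [IsDomain R] {p : R[X]} (hp : p ≠ 0) :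
    ∀ᶠ t in cofinite, p.eval t ≠ 0 :=
  (p.finite_setOfPred_isRoot hp).compl_mem_cofinite

variable {F : Type*} [Field F] {A D : F[X]}

lemma exists_isCoprime_mul_eq (p : F[X]) {q : F[X]} (hq : q ≠ 0) :
    ∃ A D : F[X], IsCoprime A D ∧ D ≠ 0 ∧ p * D = A * q := by
  classical
  obtain ⟨A, hA⟩ := EuclideanDomain.gcd_dvd_left p q
  obtain ⟨D, hD⟩ := EuclideanDomain.gcd_dvd_right p q
  refine ⟨A, D, ?_, ?_, by linear_combination D * hA - A * hD⟩
  · have hgcd : EuclideanDomain.gcd p q ≠ 0 := fun h => hq (EuclideanDomain.gcd_eq_zero_iff.mp h).2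
    refine ⟨EuclideanDomain.gcdA p q, EuclideanDomain.gcdB p q, mul_left_cancel₀ hgcd ?_⟩
    linear_combination -EuclideanDomain.gcd_eq_gcd_ab p q - EuclideanDomain.gcdA p q * hA -
      EuclideanDomain.gcdB p q * hD
  · rintro rfl
    exact hq (by rw [hD, mul_zero])

lemma eval_ne_zero_of_isCoprime (hAD : IsCoprime A D) {x t : F} (h : A.eval x = t * D.eval x) :
    D.eval x ≠ 0 := by
  obtain ⟨a, b, hab⟩ := hAD
  intro h0
  simpa [h0, h] using congrArg (Polynomial.eval x) hab

lemma eventually_natDegree_sub_C_mul (A D : F[X]) :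
    ∀ᶠ t in cofinite, (A - C t * D).natDegree = max A.natDegree D.natDegree := by
  set N := max A.natDegree D.natDegree with hN
  have hle (t : F) : (A - C t * D).natDegree ≤ N :=
    (natDegree_sub_le _ _).trans (max_le_max le_rfl (natDegree_C_mul_le t D))
  rcases Nat.eq_zero_or_pos N with h0 | hpos
  · exact .of_forall fun t => by rw [h0]; exact Nat.le_zero.mp (h0 ▸ hle t)
  have hcoeff : C (A.coeff N) - C (D.coeff N) * X ≠ 0 := by
    intro h
    have hA : A.coeff N = 0 := by simpa using congrArg (Polynomial.coeff · 0) h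
    have hD : D.coeff N = 0 := by simpa using congrArg (Polynomial.coeff · 1) h
    rcases max_choice A.natDegree D.natDegree with h | h <;>
      simp only [hN, h, coeff_natDegree, leadingCoeff_eq_zero] at hA hD hpos <;> simp_all
  filter_upwards [eventually_eval_ne_zero hcoeff] with t ht
  refine (hle t).antisymm (le_natDegree_of_ne_zero ?_)
  simpa [mul_comm t] using ht

lemma eventually_separable_sub_C_mul [IsAlgClosed F] [CharZero F] (hAD : IsCoprime A D)
    (hpos : 0 < max A.natDegree D.natDegree) : ∀ᶠ t in cofinite, (A - C t * D).Separable := by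
  have hW : wronskian A D ≠ 0 := fun h => by
    obtain ⟨hA, hD⟩ := hAD.wronskian_eq_zero_iff.mp h
    rw [derivative_eq_zero] at hA hD
    omega
  filter_upwards [eventually_forall_fiber (fun x => A.eval x / D.eval x)
    (eventually_eval_ne_zero hW)] with t ht
  refine (isCoprime_iff_aeval_ne_zero_of_isAlgClosed F F _ _).mpr fun x => ?_
  by_contra! h
  obtain ⟨hx, hx'⟩ := h
  simp only [coe_aeval_eq_eval, eval_sub, eval_mul, eval_C, derivative_sub, derivative_mul,
    derivative_C, zero_mul, zero_add] at hx hx'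
  have hfib : A.eval x = t * D.eval x := sub_eq_zero.mp hx
  refine ht x ((div_eq_iff (eval_ne_zero_of_isCoprime hAD hfib)).mpr hfib) ?_
  rw [wronskian, eval_sub, eval_mul, eval_mul]
  linear_combination (derivative D).eval x * hx - D.eval x * hx'

lemma eventually_ncard_fiber [IsAlgClosed F] [CharZero F] (hAD : IsCoprime A D)
    (hpos : 0 < max A.natDegree D.natDegree) :
    ∀ᶠ t in cofinite, {x | A.eval x = t * D.eval x}.ncard = max A.natDegree D.natDegree := by
  filter_upwards [eventually_natDegree_sub_C_mul A D, eventually_separable_sub_C_mul hAD hpos]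
    with t hdeg hsep
  classical
  have hne : A - C t * D ≠ 0 := ne_zero_of_natDegree_gt (hdeg ▸ hpos)
  have hset : {x | A.eval x = t * D.eval x} = (A - C t * D).roots.toFinset := by
    ext x
    simp [hne, sub_eq_zero]
  rw [hset, Set.ncard_coe_finset, Multiset.toFinset_card_of_nodup (nodup_roots hsep),
    IsAlgClosed.card_roots_eq_natDegree, hdeg]

end PolynomialFibres

section Coordinates

variable {Ω : Type*} [Field Ω] {E : WeierstrassCurve Ω}

/-- The `x`-coordinate of a point, with the junk value `0` at the point at infinity. -/
def xc : Pt E → Ω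
  | .zero => 0
  | .some x _ _ => x

/-- The `y`-coordinate of a point, with the junk value `0` at the point at infinity. -/
def yc : Pt E → Ω
  | .zero => 0
  | .some _ y _ => y

lemma Pt.exists_eq_some {P : Pt E} (hP : P ≠ 0) : ∃ x y h, P = Affine.Point.some x y h := by
  rcases P with _ | ⟨x, y, h⟩
  · exact absurd rfl hP
  · exact ⟨x, y, h, rfl⟩

lemma Pt.equation {P : Pt E} (hP : P ≠ 0) :
    yc P ^ 2 + E.a₁ * xc P * yc P + E.a₃ * yc P =
      xc P ^ 3 + E.a₂ * xc P ^ 2 + E.a₄ * xc P + E.a₆ := by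
  obtain ⟨x, y, h, rfl⟩ := Pt.exists_eq_some hP
  exact (Affine.equation_iff x y).mp h.1

lemma Pt.exists_of_equation [E.IsElliptic] {x y : Ω} (h : E.toAffine.Equation x y) :
    ∃ P : Pt E, P ≠ 0 ∧ xc P = x ∧ yc P = y :=
  ⟨.some x y (Affine.equation_iff_nonsingular.mp h), Affine.Point.some_ne_zero _, rfl, rfl⟩

@[simp] lemma xc_neg (P : Pt E) : xc (-P) = xc P := by
  rcases P with _ | ⟨x, y, h⟩ <;> rfl

lemma yc_neg {P : Pt E} (hP : P ≠ 0) : yc (-P) = -yc P - E.a₁ * xc P - E.a₃ := by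
  obtain ⟨x, y, h, rfl⟩ := Pt.exists_eq_some hP
  rfl

lemma Pt.ext_coord {P Q : Pt E} (hP : P ≠ 0) (hQ : Q ≠ 0) (hx : xc P = xc Q)
    (hy : yc P = yc Q) : P = Q := by
  obtain ⟨x, y, h, rfl⟩ := Pt.exists_eq_some hP
  obtain ⟨x', y', h', rfl⟩ := Pt.exists_eq_some hQ
  obtain rfl : x = x' := hx
  obtain rfl : y = y' := hy
  rfl

lemma Pt.eq_or_eq_neg {P Q : Pt E} (hP : P ≠ 0) (hQ : Q ≠ 0) (h : xc P = xc Q) :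
    P = Q ∨ P = -Q := by
  obtain ⟨x, y, hxy, rfl⟩ := Pt.exists_eq_some hP
  obtain ⟨x', y', hxy', rfl⟩ := Pt.exists_eq_some hQ
  exact Affine.Point.X_eq_iff.mp h

lemma finite_xc_fiber (t : Ω) : (xc (E := E) ⁻¹' {t}).Finite := by
  by_cases h : ∃ P : Pt E, P ≠ 0 ∧ xc P = t
  · obtain ⟨P, hP, rfl⟩ := h
    refine (Set.toFinite {0, P, -P}).subset fun Q hQ => ?_
    by_cases hQ0 : Q = 0
    · exact .inl hQ0
    · exact .inr (Pt.eq_or_eq_neg hQ0 hP hQ)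
  · push Not at h
    exact (Set.finite_singleton 0).subset fun Q hQ => by_contra fun hQ0 => h Q hQ0 hQ

lemma tendsto_xc : Tendsto (xc (E := E)) cofinite cofinite :=
  Tendsto.cofinite_of_finite_preimage_singleton finite_xc_fiber

lemma eventually_eval_xc_ne_zero {p : Polynomial Ω} (hp : p ≠ 0) :
    ∀ᶠ P : Pt E in cofinite, p.eval (xc P) ≠ 0 :=
  tendsto_xc.eventually (eventually_eval_ne_zero hp)

section IsAlgClosed

variable [IsAlgClosed Ω] [E.IsElliptic]

lemma exists_xc_eq (t : Ω) : ∃ P : Pt E, P ≠ 0 ∧ xc P = t := by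
  obtain ⟨y, hy⟩ := IsAlgClosed.exists_root
    (X ^ 2 + C (E.a₁ * t + E.a₃) * X + C (-(t ^ 3 + E.a₂ * t ^ 2 + E.a₄ * t + E.a₆)))
    (ne_of_gt (lt_of_lt_of_eq two_pos (Eq.symm (by compute_degree!))))
  have h : E.toAffine.Equation t y := by
    rw [Affine.equation_iff]
    simp only [IsRoot.def, eval_add, eval_pow, eval_X, eval_mul, eval_C] at hy
    linear_combination hy
  exact (Pt.exists_of_equation h).imp fun P hP => ⟨hP.1, hP.2.1⟩

instance infinite_pt : Infinite (Pt E) :=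
  have : Infinite Ω := IsAlgClosed.instInfinite
  .of_surjective (xc (E := E)) fun t => (exists_xc_eq t).imp fun _ h => h.2

end IsAlgClosed

end Coordinates

/-! ### Rational functions on the points of a curve -/

section Rational

variable {Ω : Type*} [Field Ω] {E : WeierstrassCurve Ω}

/-- The function `f` on the points of `E` is a rational function, up to its values at finitely many
points. By the equation of `E` it can be written as `(a(x) + b(x) y) / c(x)`. -/
def IsRat (f : Pt E → Ω) : Prop :=
  ∃ a b c : Polynomial Ω, c ≠ 0 ∧
    ∀ᶠ P in cofinite, f P = (a.eval (xc P) + b.eval (xc P) * yc P) / c.eval (xc P)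

lemma isRat_xc : IsRat (xc (E := E)) := ⟨X, 0, 1, one_ne_zero, by simp⟩

lemma isRat_yc : IsRat (yc (E := E)) := ⟨0, 1, 1, one_ne_zero, by simp⟩

namespace IsRat

variable {f g : Pt E → Ω}

lemma congr (hf : IsRat f) (h : f =ᶠ[cofinite] g) : IsRat g := by
  obtain ⟨a, b, c, hc, hfabc⟩ := hf
  exact ⟨a, b, c, hc, h.symm.trans hfabc⟩

lemma const (t : Ω) : IsRat (fun _ : Pt E => t) :=
  ⟨C t, 0, 1, one_ne_zero, by simp⟩

lemma add (hf : IsRat f) (hg : IsRat g) : IsRat (fun P => f P + g P) := by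
  obtain ⟨a, b, c, hc, hf⟩ := hf
  obtain ⟨a', b', c', hc', hg⟩ := hg
  refine ⟨a * c' + a' * c, b * c' + b' * c, c * c', mul_ne_zero hc hc', ?_⟩
  filter_upwards [hf, hg, eventually_eval_xc_ne_zero hc, eventually_eval_xc_ne_zero hc']
    with P hfP hgP hcP hcP'
  rw [hfP, hgP, div_add_div _ _ hcP hcP']
  simp only [eval_add, eval_mul]
  ring

lemma mul (hf : IsRat f) (hg : IsRat g) : IsRat (fun P => f P * g P) := by
  obtain ⟨a, b, c, hc, hf⟩ := hf
  obtain ⟨a', b', c', hc', hg⟩ := hg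
  refine ⟨a * a' + b * b' * (X ^ 3 + C E.a₂ * X ^ 2 + C E.a₄ * X + C E.a₆),
    a * b' + a' * b - b * b' * (C E.a₁ * X + C E.a₃), c * c', mul_ne_zero hc hc', ?_⟩
  filter_upwards [hf, hg, eventually_cofinite_ne 0] with P hfP hgP hP
  rw [hfP, hgP, div_mul_div_comm]
  simp only [eval_add, eval_sub, eval_mul, eval_pow, eval_X, eval_C]
  congr 1
  linear_combination (b.eval (xc P) * b'.eval (xc P)) * Pt.equation hP

lemma neg (hf : IsRat f) : IsRat (fun P => -f P) := by
  simpa only [neg_one_mul] using (const (-1)).mul hf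

lemma sub (hf : IsRat f) (hg : IsRat g) : IsRat (fun P => f P - g P) := by
  simpa only [sub_eq_add_neg] using hf.add hg.neg

lemma const_mul (t : Ω) (hf : IsRat f) : IsRat (fun P => t * f P) := (const t).mul hf

lemma pow (hf : IsRat f) (n : ℕ) : IsRat (fun P => f P ^ n) := by
  induction n with
  | zero => simpa only [pow_zero] using const 1
  | succ n ih => simpa only [pow_succ] using ih.mul hf

lemma eval (hf : IsRat f) (p : Polynomial Ω) : IsRat (fun P => p.eval (f P)) := by
  induction p using Polynomial.induction_on' with
  | add p q hp hq => simpa only [eval_add] using hp.add hq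
  | monomial n t => simpa only [eval_monomial] using (hf.pow n).const_mul t

lemma evalEval (hf : IsRat f) (hg : IsRat g) (p : Polynomial (Polynomial Ω)) :
    IsRat (fun P => p.evalEval (f P) (g P)) := by
  induction p using Polynomial.induction_on' with
  | add p q hp hq => simpa only [evalEval_add] using hp.add hq
  | monomial n t =>
    simpa only [Polynomial.evalEval, eval_monomial, eval_mul, eval_pow, eval_C]
      using (hf.eval t).mul (hg.pow n)

lemma comp_neg (hf : IsRat f) : IsRat (fun P => f (-P)) := by
  obtain ⟨a, b, c, hc, hf⟩ := hf
  refine ⟨a - b * (C E.a₁ * X + C E.a₃), -b, c, hc, ?_⟩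
  filter_upwards [neg_injective.tendsto_cofinite.eventually hf, eventually_cofinite_ne 0]
    with P hfP hP
  rw [hfP, xc_neg, yc_neg hP]
  simp only [eval_add, eval_sub, eval_neg, eval_mul, eval_X, eval_C]
  ring

end IsRat

/-- The norm of the function `a(x) + b(x) y` from the function field of `E` to the field of
rational functions of `x`. -/
noncomputable def normPoly (E : WeierstrassCurve Ω) (a b : Polynomial Ω) : Polynomial Ω :=
  a ^ 2 - a * b * (C E.a₁ * X + C E.a₃) - b ^ 2 * (X ^ 3 + C E.a₂ * X ^ 2 + C E.a₄ * X + C E.a₆)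

lemma eval_normPoly (a b : Polynomial Ω) {P : Pt E} (hP : P ≠ 0) :
    (normPoly E a b).eval (xc P) = (a.eval (xc P) + b.eval (xc P) * yc P) *
      (a.eval (xc P) + b.eval (xc P) * yc (-P)) := by
  simp only [normPoly, yc_neg hP, eval_add, eval_sub, eval_mul, eval_pow, eval_X, eval_C]
  linear_combination (b.eval (xc P)) ^ 2 * Pt.equation hP

lemma normPoly_ne_zero {a b : Polynomial Ω} (h : a ≠ 0 ∨ b ≠ 0) : normPoly E a b ≠ 0 := by
  intro h0
  have hdeg := Affine.CoordinateRing.degree_norm_smul_basis (W' := E.toAffine) a b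
  rw [Affine.CoordinateRing.norm_smul_basis, ← normPoly, h0, degree_zero] at hdeg
  obtain ⟨ha, hb⟩ := max_eq_bot.mp hdeg.symm
  rw [two_nsmul, WithBot.add_eq_bot, or_self, degree_eq_bot] at ha
  rw [WithBot.add_eq_bot, two_nsmul, WithBot.add_eq_bot, or_self, degree_eq_bot] at hb
  exact h.elim (· ha) (· (hb.resolve_right WithBot.coe_ne_bot))

namespace IsRat

variable {f g : Pt E → Ω}

lemma eventually_add_mul_yc_ne_zero {a b : Polynomial Ω} (h : a ≠ 0 ∨ b ≠ 0) :
    ∀ᶠ P : Pt E in cofinite, a.eval (xc P) + b.eval (xc P) * yc P ≠ 0 := by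
  filter_upwards [eventually_eval_xc_ne_zero (normPoly_ne_zero h), eventually_cofinite_ne 0]
    with P hN hP
  rw [eval_normPoly a b hP] at hN
  exact left_ne_zero_of_mul hN

lemma eventually_zero_or_ne_zero (hf : IsRat f) :
    (∀ᶠ P in cofinite, f P = 0) ∨ (∀ᶠ P in cofinite, f P ≠ 0) := by
  obtain ⟨a, b, c, hc, hf⟩ := hf
  by_cases h : a ≠ 0 ∨ b ≠ 0
  · right
    filter_upwards [hf, eventually_eval_xc_ne_zero hc, eventually_add_mul_yc_ne_zero h]
      with P hfP hcP hP
    exact hfP ▸ div_ne_zero hP hcP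
  · push Not at h
    left
    filter_upwards [hf] with P hfP
    simp [hfP, h.1, h.2]

lemma inv (hf : IsRat f) : IsRat (fun P => (f P)⁻¹) := by
  obtain ⟨a, b, c, -, hf⟩ := hf
  by_cases h : a ≠ 0 ∨ b ≠ 0
  · refine ⟨c * (a - b * (C E.a₁ * X + C E.a₃)), -(c * b), normPoly E a b, normPoly_ne_zero h, ?_⟩
    filter_upwards [hf, eventually_eval_xc_ne_zero (normPoly_ne_zero h),
      eventually_add_mul_yc_ne_zero h, eventually_cofinite_ne 0] with P hfP hN hab hP
    rw [hfP, inv_div, div_eq_div_iff hab hN, eval_normPoly a b hP, yc_neg hP]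
    simp only [eval_add, eval_sub, eval_neg, eval_mul, eval_X, eval_C]
    ring
  · push Not at h
    refine (const 0).congr ?_
    filter_upwards [hf] with P hfP
    simp [hfP, h.1, h.2]

lemma div (hf : IsRat f) (hg : IsRat g) : IsRat (fun P => f P / g P) := by
  simpa only [div_eq_mul_inv] using hf.mul hg.inv

end IsRat

/-- The function `f` on the points of `E` is the function `A(x) / D(x)` of `x`, in lowest terms, up
to its values at finitely many points. -/
structure IsFractionOfX (f : Pt E → Ω) (A D : Polynomial Ω) : Prop where
  isCoprime : IsCoprime A D
  ne_zero : D ≠ 0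
  eventually_eq : ∀ᶠ P in cofinite, f P * D.eval (xc P) = A.eval (xc P)

lemma IsRat.exists_isFractionOfX [CharZero Ω] {f : Pt E → Ω} (hf : IsRat f)
    (heven : ∀ᶠ P in cofinite, f (-P) = f P) : ∃ A D, IsFractionOfX f A D := by
  obtain ⟨a, b, c, hc, hf⟩ := hf
  obtain ⟨A, D, hAD, hD, hmul⟩ := exists_isCoprime_mul_eq
    (2 * a - b * (C E.a₁ * X + C E.a₃)) (mul_ne_zero two_ne_zero hc)
  refine ⟨A, D, hAD, hD, ?_⟩
  filter_upwards [hf, neg_injective.tendsto_cofinite.eventually hf, heven,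
    eventually_eval_xc_ne_zero hc, eventually_cofinite_ne 0] with P hfP hfnegP hevenP hcP hP
  have hmulP := congrArg (Polynomial.eval (xc P)) hmul
  simp only [eval_mul, eval_sub, eval_add, eval_X, eval_C, eval_ofNat] at hmulP
  rw [xc_neg, yc_neg hP, hevenP, eq_div_iff hcP] at hfnegP
  rw [eq_div_iff hcP] at hfP
  -- Twice `f P` is `f P + f (-P)`, in which the terms with `y` add up to a function of `x`.
  apply mul_left_cancel₀ (mul_ne_zero (two_ne_zero' Ω) hcP)
  linear_combination hmulP + D.eval (xc P) * (hfP + hfnegP)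

namespace IsFractionOfX

variable {f : Pt E → Ω} {A D : Polynomial Ω}

lemma eventually_fiber_iff (h : IsFractionOfX f A D) :
    ∀ᶠ t in cofinite, ∀ P, f P = t ↔ A.eval (xc P) = t * D.eval (xc P) := by
  filter_upwards [eventually_forall_fiber f h.eventually_eq,
    eventually_forall_fiber (fun P => A.eval (xc P) / D.eval (xc P))
      (h.eventually_eq.and (eventually_eval_xc_ne_zero h.ne_zero))] with t ht ht' P
  refine ⟨fun hP => hP ▸ (ht P hP).symm, fun hP => ?_⟩
  obtain ⟨hfP, hDP⟩ :=
    ht' P ((div_eq_iff (eval_ne_zero_of_isCoprime h.isCoprime hP)).mpr hP)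
  exact mul_right_cancel₀ hDP (hfP.trans hP)

lemma max_natDegree_pos [Infinite (Pt E)] (h : IsFractionOfX f A D)
    (hf : Tendsto f cofinite cofinite) : 0 < max A.natDegree D.natDegree := by
  by_contra! h0
  obtain ⟨a, rfl⟩ := natDegree_eq_zero.mp (Nat.le_zero.mp ((le_max_left _ _).trans h0))
  obtain ⟨e, rfl⟩ := natDegree_eq_zero.mp (Nat.le_zero.mp ((le_max_right _ _).trans h0))
  obtain ⟨P, hfP, hne⟩ :=
    (h.eventually_eq.and (hf.eventually (eventually_cofinite_ne (a / e)))).exists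
  rw [eval_C, eval_C] at hfP
  exact hne ((eq_div_iff (C_ne_zero.mp h.ne_zero)).mpr hfP)

end IsFractionOfX

end Rational

/-! ### Rational homomorphisms and isogenies -/

section AdditionLaw

variable {Ω : Type*} [Field Ω] {E : WeierstrassCurve Ω}

lemma IsRat.addX {f g l : Pt E → Ω} (hf : IsRat f) (hg : IsRat g) (hl : IsRat l)
    (W : WeierstrassCurve Ω) : IsRat fun P => W.toAffine.addX (f P) (g P) (l P) :=
  ((((hl.pow 2).add (hl.const_mul W.a₁)).sub (const W.a₂)).sub hf).sub hg

lemma IsRat.addY {f g h l : Pt E → Ω} (hf : IsRat f) (hg : IsRat g) (hh : IsRat h) (hl : IsRat l)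
    (W : WeierstrassCurve Ω) : IsRat fun P => W.toAffine.addY (f P) (g P) (h P) (l P) :=
  have hX := hf.addX hg hl W
  (((hl.mul (hX.sub hf)).add hh).neg.sub (hX.const_mul W.a₁)).sub (const W.a₃)

variable [DecidableEq Ω]

lemma Pt.coord_add {P Q : Pt E} (hP : P ≠ 0) (hQ : Q ≠ 0) (hPQ : P + Q ≠ 0) :
    xc (P + Q) = E.toAffine.addX (xc P) (xc Q)
        (E.toAffine.slope (xc P) (xc Q) (yc P) (yc Q)) ∧
      yc (P + Q) = E.toAffine.addY (xc P) (xc Q) (yc P)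
        (E.toAffine.slope (xc P) (xc Q) (yc P) (yc Q)) := by
  obtain ⟨x, y, h, rfl⟩ := Pt.exists_eq_some hP
  obtain ⟨x', y', h', rfl⟩ := Pt.exists_eq_some hQ
  rw [Affine.Point.add_some fun hxy => hPQ (Affine.Point.add_of_Y_eq hxy.1 hxy.2)]
  exact ⟨rfl, rfl⟩

lemma Pt.slope_of_xc_ne {P Q : Pt E} (h : xc P ≠ xc Q) :
    E.toAffine.slope (xc P) (xc Q) (yc P) (yc Q) = (yc P - yc Q) / (xc P - xc Q) :=
  Affine.slope_of_X_ne h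

lemma Pt.add_ne_zero_of_xc_ne {P Q : Pt E} (h : xc P ≠ xc Q) : P + Q ≠ 0 := fun hPQ =>
  h (by rw [eq_neg_of_add_eq_zero_left hPQ, xc_neg])

lemma Pt.two_nsmul_eq_zero_iff {P : Pt E} (hP : P ≠ 0) :
    2 • P = 0 ↔ 2 * yc P + E.a₁ * xc P + E.a₃ = 0 := by
  have hneg := yc_neg hP
  rw [two_nsmul, add_eq_zero_iff_eq_neg]
  constructor
  · intro h
    rw [← h] at hneg
    linear_combination hneg
  · intro h
    refine Pt.ext_coord hP (neg_ne_zero.mpr hP) (xc_neg P).symm ?_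
    linear_combination h - hneg

lemma Pt.slope_self {P : Pt E} (h : 2 • P ≠ 0) :
    E.toAffine.slope (xc P) (xc P) (yc P) (yc P) =
      (3 * xc P ^ 2 + 2 * E.a₂ * xc P + E.a₄ - E.a₁ * yc P) /
        (2 * yc P + E.a₁ * xc P + E.a₃) := by
  have hP : P ≠ 0 := fun h0 => h (by rw [h0, smul_zero])
  have hsub : yc P - E.toAffine.negY (xc P) (yc P) = 2 * yc P + E.a₁ * xc P + E.a₃ := by
    rw [Affine.negY]
    ring
  have hne : yc P ≠ E.toAffine.negY (xc P) (yc P) := by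
    rw [← sub_ne_zero, hsub]
    exact mt (Pt.two_nsmul_eq_zero_iff hP).mpr h
  rw [Affine.slope_of_Y_ne rfl hne, hsub]

end AdditionLaw

section GivenBy

variable {Ω : Type*} [Field Ω] {E₁ E₂ : WeierstrassCurve Ω} {u v w : Polynomial (Polynomial Ω)}

lemma givenBy_iff {φ : Pt E₁ → Pt E₂} :
    GivenBy φ u v w ↔ ∀ᶠ P in cofinite, P ≠ 0 ∧ φ P ≠ 0 ∧ w.evalEval (xc P) (yc P) ≠ 0 ∧
      xc (φ P) = u.evalEval (xc P) (yc P) / w.evalEval (xc P) (yc P) ∧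
      yc (φ P) = v.evalEval (xc P) (yc P) / w.evalEval (xc P) (yc P) := by
  rw [GivenBy, ← eventually_cofinite]
  refine eventually_congr (.of_forall fun P => ⟨?_, ?_⟩)
  · rintro ⟨x, y, h, h', rfl, hw, hP⟩
    rw [hP]
    exact ⟨Affine.Point.some_ne_zero _, Affine.Point.some_ne_zero _, hw, rfl, rfl⟩
  · rintro ⟨hP, hφP, hw, hx, hy⟩
    obtain ⟨x, y, h, rfl⟩ := Pt.exists_eq_some hP
    obtain ⟨x', y', h', hφ⟩ := Pt.exists_eq_some hφP
    rw [hφ] at hx hy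
    obtain rfl : x' = _ := hx
    obtain rfl : y' = _ := hy
    exact ⟨x, y, h, h', rfl, hw, hφ⟩

variable [DecidableEq Ω]

lemma GivenBy.eq [Infinite (Pt E₁)] {φ ψ : Pt E₁ →+ Pt E₂} (hφ : GivenBy φ u v w)
    (hψ : GivenBy ψ u v w) : φ = ψ := by
  refine addMonoidHom_eq_of_eventually_eq ?_
  filter_upwards [givenBy_iff.mp hφ, givenBy_iff.mp hψ]
    with P ⟨_, hφP, _, hφx, hφy⟩ ⟨_, hψP, _, hψx, hψy⟩
  exact Pt.ext_coord hφP hψP (hφx.trans hψx.symm) (hφy.trans hψy.symm)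

end GivenBy

section IsRatHom

variable {Ω : Type*} [Field Ω] [DecidableEq Ω] {E E₁ E₂ E₃ : WeierstrassCurve Ω}

/-- The coordinates of `φ P` are rational functions of `P`. -/
def IsRatHom (φ : Pt E₁ →+ Pt E₂) : Prop :=
  IsRat (fun P => xc (φ P)) ∧ IsRat (fun P => yc (φ P))

lemma isRatHom_id : IsRatHom (AddMonoidHom.id (Pt E)) := ⟨isRat_xc, isRat_yc⟩

lemma GivenBy.isRatHom {φ : Pt E₁ →+ Pt E₂} {u v w : Polynomial (Polynomial Ω)}
    (h : GivenBy φ u v w) : IsRatHom φ := by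
  have hcoord (p : Polynomial (Polynomial Ω)) :
      IsRat fun P : Pt E₁ => p.evalEval (xc P) (yc P) / w.evalEval (xc P) (yc P) :=
    (isRat_xc.evalEval isRat_yc p).div (isRat_xc.evalEval isRat_yc w)
  exact ⟨(hcoord u).congr <| (givenBy_iff.mp h).mono fun _ hP => hP.2.2.2.1.symm,
    (hcoord v).congr <| (givenBy_iff.mp h).mono fun _ hP => hP.2.2.2.2.symm⟩

lemma IsRatHom.exists_givenBy {φ : Pt E₁ →+ Pt E₂} (h : IsRatHom φ) (hk : Finite φ.ker) :
    ∃ u v w : Polynomial (Polynomial Ω), GivenBy φ u v w := by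
  obtain ⟨⟨a, b, c, hc, hx⟩, ⟨a', b', c', hc', hy⟩⟩ := h
  refine ⟨C (a * c') + C (b * c') * X, C (a' * c) + C (b' * c) * X, C (c * c'),
    givenBy_iff.mpr ?_⟩
  filter_upwards [hx, hy, eventually_eval_xc_ne_zero hc, eventually_eval_xc_ne_zero hc',
    eventually_cofinite_ne 0, eventually_map_ne hk 0] with P hxP hyP hcP hcP' hP hφP
  simp only [evalEval_add, evalEval_mul, evalEval_C, evalEval_X, eval_mul, hxP, hyP]
  refine ⟨hP, hφP, mul_ne_zero hcP hcP', ?_, ?_⟩ <;> field_simp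

lemma IsIsogeny.isRatHom {φ : Pt E₁ →+ Pt E₂} (h : IsIsogeny Ω φ) : IsRatHom φ := by
  obtain ⟨u, v, w, h⟩ := h.rational
  exact h.isRatHom

lemma IsIsogeny.of_subfield {k : Type*} [Field k] [Algebra k Ω] {φ : Pt E₁ →+ Pt E₂}
    (h : IsIsogeny k φ) : IsIsogeny Ω φ where
  surjective := h.surjective
  finite_ker := h.finite_ker
  rational := by
    obtain ⟨u, v, w, h⟩ := h.rational
    exact ⟨_, _, _, by simpa using h⟩

lemma IsRat.comp {f : Pt E₂ → Ω} (hf : IsRat f) {φ : Pt E₁ →+ Pt E₂} (h : IsRatHom φ)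
    (hk : Finite φ.ker) : IsRat (fun P => f (φ P)) := by
  obtain ⟨a, b, c, -, hf⟩ := hf
  refine (((h.1.eval a).add ((h.1.eval b).mul h.2)).div (h.1.eval c)).congr ?_
  filter_upwards [(tendsto_cofinite_of_finite_ker hk).eventually hf] with P hP using hP.symm

lemma IsRatHom.comp {ψ : Pt E₂ →+ Pt E₃} {φ : Pt E₁ →+ Pt E₂} (hψ : IsRatHom ψ)
    (hφ : IsRatHom φ) (hk : Finite φ.ker) : IsRatHom (ψ.comp φ) :=
  ⟨hψ.1.comp hφ hk, hψ.2.comp hφ hk⟩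

lemma IsRatHom.add {φ ψ : Pt E₁ →+ Pt E₂} (hφ : IsRatHom φ) (hψ : IsRatHom ψ)
    (hφ0 : ∀ᶠ P in cofinite, φ P ≠ 0) (hψ0 : ∀ᶠ P in cofinite, ψ P ≠ 0)
    (hne : ∀ᶠ P in cofinite, xc (φ P) ≠ xc (ψ P)) : IsRatHom (φ + ψ) := by
  have hslope : IsRat fun P =>
      E₂.toAffine.slope (xc (φ P)) (xc (ψ P)) (yc (φ P)) (yc (ψ P)) := by
    refine ((hφ.2.sub hψ.2).div (hφ.1.sub hψ.1)).congr ?_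
    filter_upwards [hne] with P hP using (Pt.slope_of_xc_ne hP).symm
  have hsum : ∀ᶠ P in cofinite, φ P ≠ 0 ∧ ψ P ≠ 0 ∧ φ P + ψ P ≠ 0 := by
    filter_upwards [hφ0, hψ0, hne] with P hφP hψP hP
    exact ⟨hφP, hψP, Pt.add_ne_zero_of_xc_ne hP⟩
  exact ⟨(hφ.1.addX hψ.1 hslope E₂).congr <| hsum.mono fun _ hP =>
      (Pt.coord_add hP.1 hP.2.1 hP.2.2).1.symm,
    (hφ.1.addY hψ.1 hφ.2 hslope E₂).congr <| hsum.mono fun _ hP =>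
      (Pt.coord_add hP.1 hP.2.1 hP.2.2).2.symm⟩

lemma IsRatHom.exists_isFractionOfX [CharZero Ω] {φ : Pt E₁ →+ Pt E₂} (h : IsRatHom φ) :
    ∃ A D, IsFractionOfX (fun P => xc (φ P)) A D :=
  h.1.exists_isFractionOfX (.of_forall fun P => by rw [map_neg, xc_neg])

lemma IsFractionOfX.max_natDegree_pos_of_finite_ker [Infinite (Pt E₁)] {φ : Pt E₁ →+ Pt E₂}
    {A D : Polynomial Ω} (h : IsFractionOfX (fun P => xc (φ P)) A D) (hk : Finite φ.ker) :
    0 < max A.natDegree D.natDegree :=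
  h.max_natDegree_pos (tendsto_xc.comp (tendsto_cofinite_of_finite_ker hk))

variable [IsAlgClosed Ω] [E₁.IsElliptic]

lemma IsFractionOfX.eventually_xc_image_fiber {φ : Pt E₁ →+ Pt E₂} {A D : Polynomial Ω}
    (h : IsFractionOfX (fun P => xc (φ P)) A D) (hk : Finite φ.ker) :
    ∀ᶠ Q in cofinite, xc '' (φ ⁻¹' {Q}) = {x | A.eval x = xc Q * D.eval x} := by
  filter_upwards [tendsto_xc.eventually h.eventually_fiber_iff,
    tendsto_xc.eventually (eventually_forall_fiber (fun P => xc (φ P)) (eventually_map_ne hk 0)),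
    eventually_cofinite_ne 0] with Q hfib hne hQ
  ext x
  constructor
  · rintro ⟨P, hP, rfl⟩
    exact (hfib P).mp (congrArg xc hP)
  · intro hx
    obtain ⟨P, -, rfl⟩ := exists_xc_eq (E := E₁) x
    have hxc := (hfib P).mpr hx
    rcases Pt.eq_or_eq_neg (hne P hxc) hQ hxc with hP | hP
    · exact ⟨P, hP, rfl⟩
    · exact ⟨-P, by simp [hP], xc_neg P⟩

variable [CharZero Ω] [E₂.IsElliptic]

lemma IsRatHom.surjective {φ : Pt E₁ →+ Pt E₂} (h : IsRatHom φ) (hk : Finite φ.ker) :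
    Function.Surjective φ := by
  obtain ⟨A, D, hAD⟩ := h.exists_isFractionOfX
  have hpos := hAD.max_natDegree_pos_of_finite_ker hk
  rw [← AddMonoidHom.range_eq_top]
  refine addSubgroup_eq_top_of_eventually_mem ?_
  filter_upwards [hAD.eventually_xc_image_fiber hk,
    tendsto_xc.eventually (eventually_ncard_fiber hAD.isCoprime hpos)] with Q himage hcard
  rw [← himage] at hcard
  obtain ⟨_, P, hP, rfl⟩ := Set.nonempty_of_ncard_ne_zero (hcard ▸ hpos.ne')
  exact ⟨P, hP⟩

lemma IsRatHom.isIsogeny {φ : Pt E₁ →+ Pt E₂} (h : IsRatHom φ) (hk : Finite φ.ker) :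
    IsIsogeny Ω φ where
  surjective := h.surjective hk
  finite_ker := hk
  rational := by
    obtain ⟨u, v, w, h⟩ := h.exists_givenBy hk
    exact ⟨u, v, w, by simpa using h⟩

lemma IsFractionOfX.max_natDegree_le_card_ker {φ : Pt E₁ →+ Pt E₂} {A D : Polynomial Ω}
    (h : IsFractionOfX (fun P => xc (φ P)) A D) (hφ : IsIsogeny Ω φ) :
    max A.natDegree D.natDegree ≤ Nat.card φ.ker := by
  have hk := hφ.finite_ker
  obtain ⟨Q, himage, hcard⟩ := ((h.eventually_xc_image_fiber hk).and
    (tendsto_xc.eventually (eventually_ncard_fiber h.isCoprime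
      (h.max_natDegree_pos_of_finite_ker hk)))).exists
  obtain ⟨P, rfl⟩ := hφ.surjective Q
  rw [← hcard, ← himage, ← ncard_fiber φ P]
  refine Set.ncard_image_le ?_
  rw [preimage_singleton_map]
  exact (Set.toFinite (φ.ker : Set (Pt E₁))).image _

end IsRatHom

lemma IsIsogeny.comp {Ω : Type*} [Field Ω] [DecidableEq Ω] {E₁ E₂ E₃ : WeierstrassCurve Ω}
    {ψ : Pt E₂ →+ Pt E₃} {φ : Pt E₁ →+ Pt E₂} (hψ : IsIsogeny Ω ψ) (hφ : IsIsogeny Ω φ) :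
    IsIsogeny Ω (ψ.comp φ) where
  surjective := hψ.surjective.comp hφ.surjective
  finite_ker := finite_ker_comp hψ.finite_ker hφ.finite_ker
  rational := by
    obtain ⟨u, v, w, h⟩ := (hψ.isRatHom.comp hφ.isRatHom hφ.finite_ker).exists_givenBy
      (finite_ker_comp hψ.finite_ker hφ.finite_ker)
    exact ⟨u, v, w, by simpa using h⟩

/-! ### Multiplication by integers -/

section SumDiff

variable {Ω : Type*} [Field Ω] {E : WeierstrassCurve Ω}

/-- The quadratic polynomial in `t`, with leading coefficient `(x₁ - x₂)²`, whose roots are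
`x(P + Q)` and `x(P - Q)` when `x(P) = x₁` and `x(Q) = x₂` are distinct. -/
noncomputable def sumDiffPoly (E : WeierstrassCurve Ω) (x₁ x₂ : Ω) : Polynomial Ω :=
  C ((x₁ - x₂) ^ 2) * X ^ 2 -
    C (2 * x₁ * x₂ * (x₁ + x₂) + E.b₂ * x₁ * x₂ + E.b₄ * (x₁ + x₂) + E.b₆) * X +
    C (x₁ ^ 2 * x₂ ^ 2 - E.b₄ * x₁ * x₂ - E.b₆ * (x₁ + x₂) - E.b₈)

lemma sumDiffPoly_ne_zero {x₁ x₂ : Ω} (h : x₁ ≠ x₂) : sumDiffPoly E x₁ x₂ ≠ 0 := by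
  refine fun h0 => pow_ne_zero 2 (sub_ne_zero.mpr h) ?_
  rw [← coeff_zero 2, ← h0, sumDiffPoly, coeff_add, coeff_sub, coeff_C_mul, coeff_C_mul,
    coeff_X_pow_self, coeff_X, coeff_C_of_ne_zero two_ne_zero]
  simp

variable [DecidableEq Ω]

lemma eval_xc_add_sumDiffPoly {P Q : Pt E} (hP : P ≠ 0) (hQ : Q ≠ 0) (h : xc P ≠ xc Q) :
    (sumDiffPoly E (xc P) (xc Q)).eval (xc (P + Q)) = 0 := by
  have hEP := Pt.equation hP
  have hEQ := Pt.equation hQ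
  have ht := (Pt.coord_add hP hQ (Pt.add_ne_zero_of_xc_ne h)).1
  rw [Pt.slope_of_xc_ne h, Affine.addX] at ht
  have hd : xc P - xc Q ≠ 0 := sub_ne_zero.mpr h
  simp only [sumDiffPoly, eval_add, eval_sub, eval_mul, eval_C, eval_pow, eval_X]
  set l := (yc P - yc Q) / (xc P - xc Q) with hl
  have hy : yc P = yc Q + l * (xc P - xc Q) := by
    rw [hl, div_mul_cancel₀ _ hd, add_sub_cancel]
  rw [hy] at hEP
  clear_value l
  generalize xc P = x₁, xc Q = x₂, xc (P + Q) = t, yc Q = y at *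
  -- The line `y = l x + n` meets `E` in points with abscissae `x₁`, `x₂` and `t`; their elementary
  -- symmetric functions are polynomials in `l` and `n`, which are then eliminated.
  obtain ⟨n, hn⟩ : ∃ n, y = l * x₂ + n := ⟨y - l * x₂, by ring⟩
  subst hn
  have hs₁ : x₁ + x₂ + t = l ^ 2 + E.a₁ * l - E.a₂ := by linear_combination ht
  have hs₂ : x₁ * x₂ + x₁ * t + x₂ * t = E.a₄ - 2 * l * n - E.a₁ * n - E.a₃ * l := by
    apply mul_left_cancel₀ hd
    linear_combination hEP - hEQ + (x₁ ^ 2 - x₂ ^ 2) * ht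
  have hs₃ : x₁ * x₂ * t = n ^ 2 + E.a₃ * n - E.a₆ := by
    linear_combination x₂ * hs₂ - hEQ - x₂ ^ 2 * ht
  rw [b₂, b₄, b₆, b₈]
  linear_combination (x₁ * x₂ + x₁ * t + x₂ * t +
      (E.a₄ - 2 * l * n - E.a₁ * n - E.a₃ * l) - (2 * E.a₄ + E.a₁ * E.a₃)) * hs₂
    - 4 * (x₁ + x₂ + t) * hs₃ - 4 * (n ^ 2 + E.a₃ * n - E.a₆) * hs₁ -
      (E.a₁ ^ 2 + 4 * E.a₂) * hs₃ - (E.a₃ ^ 2 + 4 * E.a₆) * hs₁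

lemma eval_xc_sub_sumDiffPoly {P Q : Pt E} (hP : P ≠ 0) (hQ : Q ≠ 0) (h : xc P ≠ xc Q) :
    (sumDiffPoly E (xc P) (xc Q)).eval (xc (P - Q)) = 0 := by
  rw [← xc_neg Q, sub_eq_add_neg] at *
  exact eval_xc_add_sumDiffPoly hP (neg_ne_zero.mpr hQ) h

end SumDiff

section Multiplication

variable {Ω : Type*} [Field Ω] {E : WeierstrassCurve Ω}

lemma eval_twoTorsionPolynomial {P : Pt E} (hP : P ≠ 0) :
    E.twoTorsionPolynomial.toPoly.eval (xc P) = (2 * yc P + E.a₁ * xc P + E.a₃) ^ 2 := by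
  simp only [twoTorsionPolynomial, Cubic.toPoly, eval_add, eval_mul, eval_pow, eval_X, eval_C,
    b₂, b₄, b₆]
  linear_combination -4 * Pt.equation hP

variable [DecidableEq Ω]

variable (E) in
/-- The multiplication by `n` on the points of `E`. -/
abbrev mulHom (n : ℕ) : Pt E →+ Pt E := nsmulAddMonoidHom n

variable [IsAlgClosed Ω] [CharZero Ω] [E.IsElliptic]

lemma card_roots_twoTorsionPolynomial :
    E.twoTorsionPolynomial.toPoly.roots.toFinset.card = 3 := by
  have ha : E.twoTorsionPolynomial.a ≠ 0 := by simp [twoTorsionPolynomial]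
  simpa [Cubic.map_roots] using Cubic.card_roots_of_discr_ne_zero (φ := RingHom.id Ω) ha
    (IsAlgClosed.splits _) (E.twoTorsionPolynomial_discr_ne_zero_of_isElliptic
      (isUnit_iff_ne_zero.mpr two_ne_zero))

lemma xc_image_torsion_two : xc '' {P : Pt E | P ≠ 0 ∧ 2 • P = 0} =
    E.twoTorsionPolynomial.toPoly.roots.toFinset := by
  have hne : E.twoTorsionPolynomial.toPoly ≠ 0 :=
    Cubic.ne_zero_of_a_ne_zero (by simp [twoTorsionPolynomial])
  ext x
  rw [Finset.mem_coe, Multiset.mem_toFinset, mem_roots hne, IsRoot.def]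
  constructor
  · rintro ⟨P, ⟨hP, h2⟩, rfl⟩
    rw [eval_twoTorsionPolynomial hP, (Pt.two_nsmul_eq_zero_iff hP).mp h2, sq, zero_mul]
  · intro hx
    obtain ⟨P, hP, rfl⟩ := exists_xc_eq (E := E) x
    rw [eval_twoTorsionPolynomial hP] at hx
    exact ⟨P, ⟨hP, (Pt.two_nsmul_eq_zero_iff hP).mpr (eq_zero_of_pow_eq_zero hx)⟩, rfl⟩

lemma card_torsion_two : Nat.card (torsion (Pt E) 2) = 4 := by
  set S : Set (Pt E) := {P | P ≠ 0 ∧ 2 • P = 0} with hS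
  have hinj : Set.InjOn xc S := by
    rintro P ⟨hP, -⟩ Q ⟨hQ, hQ2⟩ hPQ
    rcases Pt.eq_or_eq_neg hP hQ hPQ with rfl | rfl
    · rfl
    · rw [neg_eq_iff_add_eq_zero, ← two_nsmul, hQ2]
  have hcard : S.ncard = 3 := by
    rw [← hinj.ncard_image, xc_image_torsion_two, Set.ncard_coe_finset,
      card_roots_twoTorsionPolynomial]
  have hfin : S.Finite := Set.finite_of_ncard_ne_zero (by rw [hcard]; decide)
  have hinsert : (torsion (Pt E) 2 : Set (Pt E)) = insert 0 S := by
    ext P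
    by_cases hP : P = 0 <;> simp [hS, hP, torsion, AddMonoidHom.mem_ker]
  rw [← SetLike.coe_sort_coe, Nat.card_coe_set_eq, hinsert,
    Set.ncard_insert_of_notMem (by simp [hS]) hfin, hcard]

lemma finite_ker_mulHom_two : Finite (mulHom E 2).ker :=
  Nat.finite_of_card_ne_zero (card_torsion_two.trans_ne (by decide))

lemma isRatHom_mulHom_two : IsRatHom (mulHom E 2) := by
  have hslope : IsRat fun P : Pt E => E.toAffine.slope (xc P) (xc P) (yc P) (yc P) := by
    have hx : IsRat (xc (E := E)) := isRat_xc
    have hy : IsRat (yc (E := E)) := isRat_yc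
    have hnum := ((((hx.pow 2).const_mul 3).add (hx.const_mul (2 * E.a₂))).add
      (.const E.a₄)).sub (hy.const_mul E.a₁)
    have hden := ((hy.const_mul 2).add (hx.const_mul E.a₁)).add (.const E.a₃)
    refine (hnum.div hden).congr ?_
    filter_upwards [eventually_map_ne finite_ker_mulHom_two 0] with P hP
    exact (Pt.slope_self hP).symm
  have hne : ∀ᶠ P : Pt E in cofinite, P ≠ 0 ∧ P + P ≠ 0 := by
    filter_upwards [eventually_cofinite_ne 0, eventually_map_ne finite_ker_mulHom_two 0]
      with P hP h2P
    exact ⟨hP, by rwa [← two_nsmul]⟩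
  have htwo (P : Pt E) : mulHom E 2 P = P + P := two_nsmul P
  simp only [IsRatHom, htwo]
  exact ⟨(isRat_xc.addX isRat_xc hslope E).congr <| hne.mono fun P hP =>
      (Pt.coord_add hP.1 hP.1 hP.2).1.symm,
    (isRat_xc.addY isRat_xc isRat_yc hslope E).congr <| hne.mono fun P hP =>
      (Pt.coord_add hP.1 hP.1 hP.2).2.symm⟩

lemma exists_nsmul_ne_zero {n : ℕ} (hn : n ≠ 0) : ∃ P : Pt E, n • P ≠ 0 := by
  obtain ⟨T, hT2, hT⟩ : ∃ T ∈ torsion (Pt E) 2, T ≠ 0 :=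
    have : Finite (torsion (Pt E) 2) := finite_ker_mulHom_two
    (torsion (Pt E) 2).nontrivial_iff_exists_ne_zero.mp
      (Finite.one_lt_card_iff_nontrivial.mp (by rw [card_torsion_two]; decide))
  induction n using Nat.strong_induction_on with
  | _ n ih =>
    rcases n.even_or_odd' with ⟨k, rfl | rfl⟩
    · obtain ⟨P, hP⟩ := ih k (by lia) (by lia)
      obtain ⟨Q, rfl⟩ := isRatHom_mulHom_two.surjective finite_ker_mulHom_two P
      exact ⟨Q, by rwa [mul_comm, mul_nsmul']⟩
    · refine ⟨T, ?_⟩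
      have h2T : 2 • T = 0 := hT2
      rwa [add_nsmul, mul_nsmul, h2T, smul_zero, one_nsmul, zero_add]

lemma eventually_xc_succ_nsmul_ne {n : ℕ} (hn : n ≠ 0) (h : IsRatHom (mulHom E (n + 1)))
    (hk : Finite (mulHom E (n + 1)).ker) :
    ∀ᶠ P : Pt E in cofinite, xc ((n + 1) • P) ≠ xc P := by
  refine ((h.1.sub isRat_xc).eventually_zero_or_ne_zero.resolve_left fun h0 => ?_).mono
    fun P => sub_ne_zero.mp
  obtain ⟨P, hP⟩ := exists_nsmul_ne_zero (E := E) (n := n * (n + 2)) (by positivity)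
  refine hP (DFunLike.congr_fun (addMonoidHom_eq_of_eventually_eq (φ := mulHom E (n * (n + 2)))
    (ψ := 0) ?_) P)
  filter_upwards [h0, eventually_map_ne hk 0, eventually_cofinite_ne 0] with P hxc hnP hP
  change (n * (n + 2)) • P = 0
  rcases Pt.eq_or_eq_neg hnP hP (sub_eq_zero.mp hxc) with hsucc | hsucc
  · have hzero : n • P = 0 := by simpa [add_nsmul] using hsucc
    rw [mul_nsmul, hzero, smul_zero]
  · have hzero : (n + 2) • P = 0 := by
      rw [show n + 2 = n + 1 + 1 from rfl, add_nsmul, one_nsmul]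
      exact eq_neg_iff_add_eq_zero.mp hsucc
    rw [mul_nsmul', hzero, smul_zero]

lemma isRatHom_mulHom_succ (n : ℕ) :
    IsRatHom (mulHom E (n + 1)) ∧ Finite (mulHom E (n + 1)).ker := by
  induction n with
  | zero =>
    rw [show mulHom E (0 + 1) = AddMonoidHom.id _ by ext; simp]
    exact ⟨isRatHom_id, by rw [AddMonoidHom.ker_id]; infer_instance⟩
  | succ n ih =>
    obtain ⟨h, hk⟩ := ih
    rcases Nat.eq_zero_or_pos n with rfl | hn
    · exact ⟨isRatHom_mulHom_two, finite_ker_mulHom_two⟩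
    have hne := eventually_xc_succ_nsmul_ne hn.ne' h hk
    rw [show mulHom E (n + 1 + 1) = mulHom E (n + 1) + AddMonoidHom.id _ by
      ext P
      simp [add_nsmul]]
    refine ⟨h.add isRatHom_id (eventually_map_ne hk 0) (eventually_cofinite_ne 0) hne, ?_⟩
    exact (eventually_cofinite.mp hne).subset fun P hP => not_not.mpr <| by
      change (n + 1) • P + P = 0 at hP
      rw [eq_neg_of_add_eq_zero_left hP, xc_neg]

lemma isIsogeny_mulHom {n : ℕ} (hn : n ≠ 0) : IsIsogeny Ω (mulHom E n) := by
  obtain ⟨n, rfl⟩ := Nat.exists_eq_succ_of_ne_zero hn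
  exact (isRatHom_mulHom_succ n).1.isIsogeny (isRatHom_mulHom_succ n).2

end Multiplication

/-! ### The order of the torsion subgroups -/

section AddRelation

variable {Ω : Type*} [Field Ω] {E : WeierstrassCurve Ω} {A D : Polynomial Ω}

/-- The numerator of the polynomial relation between `x = x(P)` and `t = x(φ(P) ± P)`, for an
endomorphism `φ` of `E` with `x(φ(P)) = A(x) / D(x)`. It is a polynomial in `x`. -/
noncomputable def addRelation (E : WeierstrassCurve Ω) (A D : Polynomial Ω) (t : Ω) :
    Polynomial Ω :=
  C t ^ 2 * (A - X * D) ^ 2 - C t * (2 * A * X * (A + X * D) + C E.b₂ * A * X * D +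
      C E.b₄ * (A + X * D) * D + C E.b₆ * D ^ 2) +
    (A ^ 2 * X ^ 2 - C E.b₄ * A * X * D - C E.b₆ * (A + X * D) * D - C E.b₈ * D ^ 2)

lemma eval_addRelation {s x : Ω} (h : s * D.eval x = A.eval x) (t : Ω) :
    (addRelation E A D t).eval x = D.eval x ^ 2 * (sumDiffPoly E s x).eval t := by
  simp only [addRelation, sumDiffPoly, eval_add, eval_sub, eval_mul, eval_pow, eval_C, eval_X,
    eval_ofNat, ← h]
  ring

lemma natDegree_addRelation_le (t : Ω) :
    (addRelation E A D t).natDegree ≤ 2 * max A.natDegree D.natDegree + 2 := by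
  rw [addRelation]
  compute_degree
  omega

lemma eventually_addRelation_ne_zero {s x : Ω} (h : s * D.eval x = A.eval x)
    (hD : D.eval x ≠ 0) (hne : s ≠ x) : ∀ᶠ t in cofinite, addRelation E A D t ≠ 0 := by
  filter_upwards [eventually_eval_ne_zero (sumDiffPoly_ne_zero (E := E) hne)] with t ht h0
  refine mul_ne_zero (pow_ne_zero 2 hD) ht ?_
  rw [← eval_addRelation h, h0, eval_zero]

end AddRelation

section FibreUnion

variable {A : Type*} [AddCommGroup A]

lemma card_torsion_one : Nat.card (torsion A 1) = 1 := by
  rw [AddSubgroup.card_eq_one, eq_bot_iff]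
  exact fun P hP => by simpa [torsion, AddMonoidHom.mem_ker] using hP

/-- The points `P` with `(n + 1)P + P = Q` or `(n + 1)P - P = Q`. -/
def fibreUnion (n : ℕ) (Q : A) : Set A := {P | (n + 2) • P = Q} ∪ {P | n • P = Q}

lemma eq_add_or_sub_of_mem_fibreUnion {n : ℕ} {P Q : A} (h : P ∈ fibreUnion n Q) :
    Q = (n + 1) • P + P ∨ Q = (n + 1) • P - P := by
  refine h.imp (fun h => ?_) (fun h => ?_)
  · rw [← succ_nsmul, ← h]
  · rw [succ_nsmul, add_sub_cancel_right, ← h]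

lemma two_nsmul_eq_zero_of_neg_mem_fibreUnion {n : ℕ} {P Q : A} (hP : P ∈ fibreUnion n Q)
    (hnegP : -P ∈ fibreUnion n Q) : 2 • Q = 0 ∨ (2 * (n + 1)) • P = 0 := by
  simp only [fibreUnion, Set.mem_union, Set.mem_ofPred_eq] at hP hnegP
  rcases hP with hP | hP <;> rcases hnegP with hnegP | hnegP
  · left
    rw [two_nsmul]
    nth_rw 1 [← hP, ← hnegP]
    rw [smul_neg, add_neg_cancel]
  · right
    rw [← sub_eq_zero.mpr (hP.trans hnegP.symm)]
    module
  · right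
    rw [← neg_eq_zero, ← sub_eq_zero.mpr (hnegP.trans hP.symm)]
    module
  · left
    rw [two_nsmul]
    nth_rw 1 [← hP, ← hnegP]
    rw [smul_neg, add_neg_cancel]

end FibreUnion

section Parallelogram

variable {Ω : Type*} [Field Ω] [DecidableEq Ω] {E : WeierstrassCurve Ω}
variable [IsAlgClosed Ω] [CharZero Ω] [E.IsElliptic]

lemma ncard_mulHom_fiber {n : ℕ} (hn : n ≠ 0) (Q : Pt E) :
    {P : Pt E | n • P = Q}.ncard = Nat.card (torsion (Pt E) n) := by
  obtain ⟨P, rfl⟩ := (isIsogeny_mulHom hn).surjective Q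
  exact ncard_fiber (mulHom E n) P

lemma finite_mulHom_fiber {n : ℕ} (hn : n ≠ 0) (Q : Pt E) : {P : Pt E | n • P = Q}.Finite := by
  have : Finite (torsion (Pt E) n) := (isIsogeny_mulHom hn).finite_ker
  exact Set.finite_of_ncard_ne_zero (by rw [ncard_mulHom_fiber hn]; exact Nat.card_pos.ne')

lemma eventually_ncard_xc_image_fibreUnion {n : ℕ} (hn : n ≠ 0) :
    ∀ᶠ Q : Pt E in cofinite, (xc '' fibreUnion n Q).ncard =
      Nat.card (torsion (Pt E) (n + 2)) + Nat.card (torsion (Pt E) n) := by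
  have hker {k : ℕ} (hk : k ≠ 0) : ∀ᶠ P : Pt E in cofinite, k • P ≠ 0 :=
    eventually_map_ne (isIsogeny_mulHom hk).finite_ker 0
  have hgood : ∀ᶠ P : Pt E in cofinite, P ≠ 0 ∧ 2 • P ≠ 0 ∧ (2 * (n + 1)) • P ≠ 0 :=
    (eventually_cofinite_ne 0).and ((hker two_ne_zero).and (hker (by lia)))
  filter_upwards [eventually_forall_fiber (mulHom E (n + 2)) hgood,
    eventually_forall_fiber (mulHom E n) hgood, hker two_ne_zero] with Q hadd hsub hQ
  have hmem {P : Pt E} (hP : P ∈ fibreUnion n Q) := hP.elim (hadd P) (hsub P)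
  have hinj : Set.InjOn xc (fibreUnion n Q) := by
    intro P hP P' hP' hx
    rcases Pt.eq_or_eq_neg (hmem hP).1 (hmem hP').1 hx with heq | rfl
    · exact heq
    · exact ((two_nsmul_eq_zero_of_neg_mem_fibreUnion hP' hP).elim hQ (hmem hP').2.2).elim
  have hdisj : Disjoint {P : Pt E | (n + 2) • P = Q} {P : Pt E | n • P = Q} := by
    refine Set.disjoint_left.mpr fun P hP hP' => (hmem (.inl hP)).2.1 ?_
    rwa [Set.mem_ofPred_eq, add_nsmul, hP', add_eq_left] at hP
  rw [hinj.ncard_image, fibreUnion, Set.ncard_union_eq hdisj (finite_mulHom_fiber (by lia) Q)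
    (finite_mulHom_fiber hn Q), ncard_mulHom_fiber (by lia), ncard_mulHom_fiber hn]

lemma eventually_addRelation_eval_eq_zero {n : ℕ} (hn : n ≠ 0) {A D : Polynomial Ω}
    (h : IsFractionOfX (fun P : Pt E => xc ((n + 1) • P)) A D) :
    ∀ᶠ Q : Pt E in cofinite, addRelation E A D (xc Q) ≠ 0 ∧
      ∀ x ∈ xc '' fibreUnion n Q, (addRelation E A D (xc Q)).eval x = 0 := by
  have hmul := isIsogeny_mulHom (E := E) n.succ_ne_zero
  have hgood : ∀ᶠ P : Pt E in cofinite, P ≠ 0 ∧ (n + 1) • P ≠ 0 ∧ xc ((n + 1) • P) ≠ xc P ∧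
      D.eval (xc P) ≠ 0 ∧ xc ((n + 1) • P) * D.eval (xc P) = A.eval (xc P) :=
    (eventually_cofinite_ne 0).and <| (eventually_map_ne hmul.finite_ker 0).and <|
      (eventually_xc_succ_nsmul_ne hn hmul.isRatHom hmul.finite_ker).and <|
        (eventually_eval_xc_ne_zero h.ne_zero).and h.eventually_eq
  obtain ⟨P₀, -, -, hne, hD, hA⟩ := hgood.exists
  filter_upwards [eventually_forall_fiber (mulHom E (n + 2)) hgood,
    eventually_forall_fiber (mulHom E n) hgood,
    tendsto_xc.eventually (eventually_addRelation_ne_zero (E := E) hA hD hne)]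
    with Q hadd hsub hQ
  refine ⟨hQ, ?_⟩
  rintro _ ⟨P, hP, rfl⟩
  obtain ⟨hP0, hnP, hxc, -, hAP⟩ := hP.elim (hadd P) (hsub P)
  rw [eval_addRelation hAP]
  rcases eq_add_or_sub_of_mem_fibreUnion hP with rfl | rfl
  · rw [eval_xc_add_sumDiffPoly hnP hP0 hxc, mul_zero]
  · rw [eval_xc_sub_sumDiffPoly hnP hP0 hxc, mul_zero]

lemma card_torsion_add_le {n : ℕ} (hn : n ≠ 0) :
    Nat.card (torsion (Pt E) (n + 2)) + Nat.card (torsion (Pt E) n) ≤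
      2 * Nat.card (torsion (Pt E) (n + 1)) + 2 := by
  have hmul := isIsogeny_mulHom (E := E) n.succ_ne_zero
  obtain ⟨A, D, h⟩ := hmul.isRatHom.exists_isFractionOfX
  obtain ⟨Q, hcard, hne, hroot⟩ := ((eventually_ncard_xc_image_fibreUnion (E := E) hn).and
    (eventually_addRelation_eval_eq_zero hn h)).exists
  have hsub : xc '' fibreUnion n Q ⊆ (addRelation E A D (xc Q)).roots.toFinset := fun x hx =>
    Multiset.mem_toFinset.mpr ((mem_roots hne).mpr (hroot x hx))
  calc Nat.card (torsion (Pt E) (n + 2)) + Nat.card (torsion (Pt E) n)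
    _ ≤ (addRelation E A D (xc Q)).roots.toFinset.card := by
      rw [← hcard, ← Set.ncard_coe_finset]
      exact Set.ncard_le_ncard hsub (Finset.finite_toSet _)
    _ ≤ (addRelation E A D (xc Q)).natDegree :=
      (Multiset.toFinset_card_le _).trans (card_roots' _)
    _ ≤ 2 * max A.natDegree D.natDegree + 2 := natDegree_addRelation_le _
    _ ≤ 2 * Nat.card (torsion (Pt E) (n + 1)) + 2 := by
      gcongr
      exact h.max_natDegree_le_card_ker hmul

lemma card_torsion_mul {m n : ℕ} (hm : m ≠ 0) : Nat.card (torsion (Pt E) (m * n)) =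
    Nat.card (torsion (Pt E) m) * Nat.card (torsion (Pt E) n) := by
  have hcomp : torsion (Pt E) (m * n) = ((mulHom E n).comp (mulHom E m)).ker := by
    ext P
    simp [torsion, AddMonoidHom.mem_ker, mul_nsmul]
  rw [hcomp]
  exact card_ker_comp (isIsogeny_mulHom hm).surjective

lemma card_torsion_two_pow (k : ℕ) : Nat.card (torsion (Pt E) (2 ^ k)) = 4 ^ k := by
  induction k with
  | zero => exact card_torsion_one
  | succ k ih => rw [pow_succ, card_torsion_mul (by positivity), ih, card_torsion_two, pow_succ]

end Parallelogram

lemma eq_zero_of_convex_of_frequently_eq_zero {e : ℕ → ℤ}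
    (hconv : ∀ n, 2 * e (n + 1) ≤ e (n + 2) + e n) (h0 : e 0 = 0) (h1 : e 1 = 0)
    (hfreq : ∀ n, ∃ m ≥ n, e m = 0) (n : ℕ) : e n = 0 := by
  have hstep (n : ℕ) : e n ≤ e (n + 1) := by
    induction n with
    | zero => rw [h0, zero_add, h1]
    | succ n ih => linarith [hconv n]
  have hmono : Monotone e := monotone_nat_of_le_succ hstep
  obtain ⟨m, hnm, hm⟩ := hfreq n
  exact le_antisymm ((hmono hnm).trans_eq hm) (h0.symm.trans_le (hmono n.zero_le))

theorem card_torsion {Ω : Type*} [Field Ω] [DecidableEq Ω] [IsAlgClosed Ω] [CharZero Ω]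
    {E : WeierstrassCurve Ω} [E.IsElliptic] {n : ℕ} (hn : n ≠ 0) :
    Nat.card (torsion (Pt E) n) = n ^ 2 := by
  obtain ⟨n, rfl⟩ := Nat.exists_eq_succ_of_ne_zero hn
  refine Nat.cast_injective (R := ℤ) (sub_eq_zero.mp ?_).symm
  refine eq_zero_of_convex_of_frequently_eq_zero
    (e := fun n => ((n + 1 : ℕ) ^ 2 : ℕ) - (Nat.card (torsion (Pt E) (n + 1)) : ℤ))
    (fun n => ?_) (by simp [card_torsion_one]) (by simp [card_torsion_two])
    (fun n => ⟨2 ^ n - 1, Nat.le_sub_one_of_lt Nat.lt_two_pow_self, ?_⟩) n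
  · have := card_torsion_add_le (E := E) n.succ_ne_zero
    push_cast
    zify at this
    linarith
  · rw [Nat.sub_add_cancel Nat.one_le_two_pow, card_torsion_two_pow, ← pow_mul, mul_comm, pow_mul]
    simp

/-! ### Torsion and finite cyclic subgroups of abelian groups -/

section Torsion

variable {A B : Type*} [AddCommGroup A] [AddCommGroup B]

lemma le_torsion_card (C : AddSubgroup A) : C ≤ torsion A (Nat.card C) := fun x hx =>
  congrArg Subtype.val (card_nsmul_eq_zero' (x := (⟨x, hx⟩ : C)))

lemma torsion_inf_torsion (m n : ℕ) : torsion A m ⊓ torsion A n = torsion A (m.gcd n) :=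
  AddSubgroup.ext fun _ => gcd_nsmul_eq_zero.symm

lemma eq_zero_of_mem_torsion_of_coprime {m n : ℕ} (hmn : m.Coprime n) {x : A}
    (hm : x ∈ torsion A m) (hn : x ∈ torsion A n) : x = 0 := by
  have hgcd : x ∈ torsion A (m.gcd n) := torsion_inf_torsion (A := A) m n ▸ ⟨hm, hn⟩
  rw [hmn] at hgcd
  exact (one_nsmul x).symm.trans hgcd

lemma sup_inf_torsion {C₁ C₂ : AddSubgroup A} {m n : ℕ} (hmn : m.Coprime n)
    (h₁ : C₁ ≤ torsion A m) (h₂ : C₂ ≤ torsion A n) : (C₁ ⊔ C₂) ⊓ torsion A m = C₁ := by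
  rw [sup_inf_assoc_of_le C₂ h₁, sup_eq_left]
  rintro x ⟨hx, hxm⟩
  rw [eq_zero_of_mem_torsion_of_coprime hmn hxm (h₂ hx)]
  exact zero_mem C₁

lemma zmultiples_add_eq_sup {x y : A} (h : (addOrderOf x).Coprime (addOrderOf y)) :
    AddSubgroup.zmultiples (x + y) = AddSubgroup.zmultiples x ⊔ AddSubgroup.zmultiples y := by
  have hmem {x y : A} (h : (addOrderOf x).Coprime (addOrderOf y)) :
      x ∈ AddSubgroup.zmultiples (x + y) := by
    have hx : x ∈ AddSubgroup.zmultiples (addOrderOf y • x) :=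
      mem_zmultiples_nsmul_iff.mpr h.symm
    have hxy : addOrderOf y • x = addOrderOf y • (x + y) := by
      rw [smul_add, addOrderOf_nsmul_eq_zero, add_zero]
    rw [hxy] at hx
    exact AddSubgroup.zmultiples_le_of_mem (AddSubgroup.nsmul_mem_zmultiples _ _) hx
  refine le_antisymm ?_ (sup_le ?_ ?_) <;> rw [AddSubgroup.zmultiples_le]
  · exact AddSubgroup.add_mem_sup (AddSubgroup.mem_zmultiples x) (AddSubgroup.mem_zmultiples y)
  · exact hmem h
  · exact add_comm y x ▸ hmem h.symm

lemma isAddCyclic_sup_and_card {C₁ C₂ : AddSubgroup A} (h₁ : IsAddCyclic C₁)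
    (h₂ : IsAddCyclic C₂) (h : (Nat.card C₁).Coprime (Nat.card C₂)) :
    IsAddCyclic (C₁ ⊔ C₂ : AddSubgroup A) ∧
      Nat.card (C₁ ⊔ C₂ : AddSubgroup A) = Nat.card C₁ * Nat.card C₂ := by
  obtain ⟨x, rfl⟩ := (AddSubgroup.isAddCyclic_iff_exists_zmultiples_eq_top C₁).mp h₁
  obtain ⟨y, rfl⟩ := (AddSubgroup.isAddCyclic_iff_exists_zmultiples_eq_top C₂).mp h₂
  rw [Nat.card_zmultiples, Nat.card_zmultiples] at h ⊢
  rw [← zmultiples_add_eq_sup h, Nat.card_zmultiples,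
    (AddCommute.all x y).addOrderOf_add_eq_mul_addOrderOf_of_coprime h]
  exact ⟨inferInstance, rfl⟩

lemma map_torsion_of_coprime {φ : A →+ B} (hφ : Function.Surjective φ) {n : ℕ}
    (hn : n.Coprime (Nat.card φ.ker)) : (torsion A n).map φ = torsion B n := by
  refine le_antisymm ?_ fun b hb => ?_
  · rintro _ ⟨a, ha, rfl⟩
    exact (map_nsmul φ n a).symm.trans ((congrArg φ ha).trans (map_zero φ))
  · set d := Nat.card φ.ker
    obtain ⟨k, hk⟩ : b ∈ AddSubgroup.zmultiples (d • b) := mem_zmultiples_nsmul_iff.mpr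
      (Nat.Coprime.coprime_dvd_right (addOrderOf_dvd_of_nsmul_eq_zero hb) hn.symm)
    obtain ⟨a, rfl⟩ := hφ b
    have hna : n • a ∈ φ.ker := (map_nsmul φ n a).trans hb
    refine ⟨k • d • a, ?_, ?_⟩
    · change n • k • d • a = 0
      rw [smul_comm n k, smul_comm n d, show d • n • a = 0 from le_torsion_card φ.ker hna,
        smul_zero]
    · rw [map_zsmul, map_nsmul]
      exact hk

lemma addOrderOf_map_of_coprime (φ : A →+ B) {x : A}
    (hx : (addOrderOf x).Coprime (Nat.card φ.ker)) : addOrderOf (φ x) = addOrderOf x := by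
  refine Nat.dvd_antisymm (addOrderOf_map_dvd φ x) (addOrderOf_dvd_of_nsmul_eq_zero ?_)
  have hker : addOrderOf (φ x) • x ∈ φ.ker :=
    (map_nsmul φ _ x).trans (addOrderOf_nsmul_eq_zero (φ x))
  refine eq_zero_of_mem_torsion_of_coprime hx ?_ (le_torsion_card φ.ker hker)
  exact (smul_comm _ _ x).trans (by rw [addOrderOf_nsmul_eq_zero, smul_zero])

lemma ker_units_smul (s : ℤˣ) (φ : A →+ B) : (s • φ).ker = φ.ker := by
  ext a
  exact smul_eq_zero_iff_eq s

lemma comp_eq_nsmul_of_comp_eq_nsmul {φ : A →+ B} {ψ : B →+ A} (hφ : Function.Surjective φ) {n : ℕ}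
    (h : ψ.comp φ = nsmulAddMonoidHom n) : φ.comp ψ = nsmulAddMonoidHom n := by
  refine DFunLike.ext _ _ fun b => ?_
  obtain ⟨a, rfl⟩ := hφ b
  exact (congrArg φ (DFunLike.congr_fun h a)).trans (map_nsmul φ n a)

lemma ker_eq_map_torsion_of_comp_eq {φ : A →+ B} {ψ : B →+ A} (hφ : Function.Surjective φ) {n : ℕ}
    {s : ℤˣ} (h : ψ.comp φ = s • nsmulAddMonoidHom n) : ψ.ker = (torsion A n).map φ := by
  rw [torsion, ← ker_units_smul (A := A) s, ← h, ← AddMonoidHom.comap_ker,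
    AddSubgroup.map_comap_eq_self_of_surjective hφ]

end Torsion

section CyclicComposite

variable {A A' B B' : Type*} [AddCommGroup A] [AddCommGroup A'] [AddCommGroup B] [AddCommGroup B']
  {φ : A →+ B} {ψ : B →+ A} {μ : A →+ A'} {φ' : A' →+ B'} {m : ℕ}

lemma exists_mem_torsion_of_map_ker_ne (hm : m ≠ 0) (hμ : Function.Surjective μ)
    (hmμ : m.Coprime (Nat.card μ.ker)) (hφ : Nat.card φ.ker = m) (hφ' : Nat.card φ'.ker = m)
    (hne : φ.ker.map μ ≠ φ'.ker) : ∃ a ∈ torsion A m, φ' (μ a) = 0 ∧ φ a ≠ 0 := by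
  have : Finite φ.ker := Nat.finite_of_card_ne_zero (hφ ▸ hm)
  have : Finite (φ.ker.map μ) := Set.Finite.image μ (Set.toFinite (φ.ker : Set A))
  have hle : ¬ φ'.ker ≤ φ.ker.map μ := fun hle => hne (AddSubgroup.eq_of_le_of_card_ge hle <| by
    rw [hφ', ← hφ]
    exact Nat.card_le_card_of_surjective _ (μ.addSubgroupMap_surjective φ.ker)).symm
  obtain ⟨q, hq, hqφ⟩ := SetLike.not_le_iff_exists.mp hle
  have hqm : q ∈ torsion A' m := hφ' ▸ le_torsion_card φ'.ker hq
  rw [← map_torsion_of_coprime hμ hmμ] at hqm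
  obtain ⟨a, ha, rfl⟩ := hqm
  exact ⟨a, ha, hq, fun h => hqφ ⟨a, h, rfl⟩⟩

lemma exists_mem_ker_comp_addOrderOf_eq_sq (hm : m.Prime) (hψ : Function.Surjective ψ)
    (hμ : Function.Surjective μ) (hmμ : m.Coprime (Nat.card μ.ker))
    (hφψ : φ.comp ψ = nsmulAddMonoidHom m) (hφ : Nat.card φ.ker = m)
    (hφ' : Nat.card φ'.ker = m) (hne : φ.ker.map μ ≠ φ'.ker) :
    ∃ b ∈ (φ'.comp (μ.comp ψ)).ker, addOrderOf b = m ^ 2 := by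
  have : Fact m.Prime := ⟨hm⟩
  obtain ⟨a, ham, haφ', haφ⟩ := exists_mem_torsion_of_map_ker_ne hm.ne_zero hμ hmμ hφ hφ' hne
  obtain ⟨b, rfl⟩ := hψ a
  have hmb : m • b = φ (ψ b) := (DFunLike.congr_fun hφψ b).symm
  refine ⟨b, haφ', addOrderOf_eq_prime_pow (n := 1) ?_ ?_⟩
  · rwa [pow_one, hmb]
  · rw [pow_succ, pow_one, mul_smul, hmb, ← map_nsmul, show m • ψ b = 0 from ham, map_zero]

lemma hasCyclicKernel_comp {d : ℕ} (hm : m.Prime) (hmd : m.Coprime d) (hd : d ≠ 0)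
    (hψ : Function.Surjective ψ) (hμ : Function.Surjective μ)
    (hψφ : ψ.comp φ = nsmulAddMonoidHom m) (hφψ : φ.comp ψ = nsmulAddMonoidHom m)
    (hφm : Nat.card φ.ker = m) (hψm : Nat.card ψ.ker = m) (hμd : HasCyclicKernel μ d)
    (hφ'm : Nat.card φ'.ker = m) (hne : φ.ker.map μ ≠ φ'.ker) :
    HasCyclicKernel (φ'.comp (μ.comp ψ)) (d * m ^ 2) := by
  obtain ⟨hμcyc, rfl⟩ := hμd
  set d := Nat.card μ.ker
  set χ := φ'.comp (μ.comp ψ) with hχ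
  have hcard : Nat.card χ.ker = d * m ^ 2 := by
    rw [card_ker_comp (φ := μ.comp ψ) (hμ.comp hψ), card_ker_comp hψ, hψm, hφ'm]
    ring
  obtain ⟨x, hx⟩ := (AddSubgroup.isAddCyclic_iff_exists_zmultiples_eq_top μ.ker).mp hμcyc
  have hμx : μ x = 0 := hx.le (AddSubgroup.mem_zmultiples x)
  have hxd : addOrderOf x = d := by rw [← Nat.card_zmultiples, hx]
  have hφx : addOrderOf (φ x) = d := by
    rw [addOrderOf_map_of_coprime φ (by rw [hφm, hxd]; exact hmd.symm), hxd]
  have hφxχ : φ x ∈ χ.ker := by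
    have hψφx : ψ (φ x) = m • x := DFunLike.congr_fun hψφ x
    rw [AddMonoidHom.mem_ker, hχ, AddMonoidHom.comp_apply, AddMonoidHom.comp_apply, hψφx,
      map_nsmul, hμx, smul_zero, map_zero]
  obtain ⟨b, hbχ, hb⟩ := exists_mem_ker_comp_addOrderOf_eq_sq hm hψ hμ hmd hφψ hφm hφ'm hne
  have hcop : (addOrderOf (φ x)).Coprime (addOrderOf b) := by
    rw [hφx, hb]
    exact hmd.symm.pow_right 2
  have : Finite χ.ker :=
    Nat.finite_of_card_ne_zero (hcard ▸ mul_ne_zero hd (pow_ne_zero 2 hm.ne_zero))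
  refine ⟨isAddCyclic_of_addOrderOf_eq_card ⟨φ x + b, add_mem hφxχ hbχ⟩ ?_, hcard⟩
  rw [AddSubgroup.addOrderOf_mk,
    (AddCommute.all _ _).addOrderOf_add_eq_mul_addOrderOf_of_coprime hcop, hφx, hb, hcard]

end CyclicComposite

/-! ### The dual isogeny -/

section Interpolation

variable {F : Type*} [Field F] {A D H : F[X]} {k : ℕ}

lemma natDegree_aeval_homogenize_le (A D H : F[X]) (k : ℕ) :
    (MvPolynomial.aeval ![A, D] (H.homogenize k)).natDegree ≤
      k * max A.natDegree D.natDegree := by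
  refine MvPolynomial.aeval_natDegree_le _ H.isHomogeneous_homogenize.totalDegree_le _ fun i => ?_
  fin_cases i
  exacts [le_max_left _ _, le_max_right _ _]

lemma eval_aeval_homogenize (hAD : IsCoprime A D) (hH : H.natDegree ≤ k) {x t : F}
    (h : A.eval x = t * D.eval x) :
    (MvPolynomial.aeval ![A, D] (H.homogenize k)).eval x = H.eval t * D.eval x ^ k := by
  have hD := eval_ne_zero_of_isCoprime hAD h
  have hcomp : (aeval x).comp (MvPolynomial.aeval ![A, D]) =
      MvPolynomial.aeval ![A.eval x, D.eval x] := by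
    ext i
    fin_cases i <;> simp
  have heval : (MvPolynomial.aeval ![A, D] (H.homogenize k)).eval x =
      MvPolynomial.eval ![A.eval x, D.eval x] (H.homogenize k) := by
    rw [← MvPolynomial.coe_aeval_eq_eval, ← hcomp]
    rfl
  rw [heval, eval_homogenize hH ![A.eval x, D.eval x] hD]
  simp only [Matrix.cons_val_zero, Matrix.cons_val_one, h, mul_div_cancel_right₀ t hD]

lemma exists_interpolation (k : ℕ) (T : Finset F) (hT : T.card ≤ 2 * k + 1) (v : F → F) :
    ∃ H₁ H₂ : F[X], (H₁ ≠ 0 ∨ H₂ ≠ 0) ∧ H₁.natDegree ≤ k ∧ H₂.natDegree ≤ k ∧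
      ∀ t ∈ T, H₁.eval t = v t * H₂.eval t := by
  let V := degreeLT F (k + 1)
  let L : V × V →ₗ[F] (T → F) :=
    LinearMap.pi fun t => (leval (t : F) ∘ₗ V.subtype) ∘ₗ LinearMap.fst F V V -
      v t • ((leval (t : F) ∘ₗ V.subtype) ∘ₗ LinearMap.snd F V V)
  have : Module.Finite F V := Module.Finite.equiv (degreeLTEquiv F (k + 1)).symm
  have hV : Module.finrank F V = k + 1 := by
    rw [(degreeLTEquiv F (k + 1)).finrank_eq, Module.finrank_fin_fun]
  have hlt : Module.finrank F (T → F) < Module.finrank F (V × V) := by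
    rw [Module.finrank_prod, hV, Module.finrank_fintype_fun_eq_card, Fintype.card_coe]
    lia
  obtain ⟨⟨H₁, H₂⟩, hL, hne⟩ := Submodule.exists_mem_ne_zero_of_ne_bot
    (LinearMap.ker_ne_bot_of_finrank_lt (f := L) hlt)
  have hdeg (H : V) : (H : F[X]).natDegree ≤ k :=
    natDegree_le_iff_degree_le.mpr
      (mem_degreeLE.mp (degreeLT_succ_eq_degreeLE (R := F) (n := k) ▸ H.2))
  refine ⟨H₁, H₂, ?_, hdeg H₁, hdeg H₂,
    fun t ht => sub_eq_zero.mp (congrFun (LinearMap.mem_ker.mp hL) ⟨t, ht⟩)⟩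
  contrapose! hne
  exact Prod.ext (Subtype.ext hne.1) (Subtype.ext hne.2)

lemma eq_zero_of_eval_fibers_eq_zero (hAD : IsCoprime A D) {p : F[X]} {T : Finset F} {N : ℕ}
    (hN : ∀ t ∈ T, {x | A.eval x = t * D.eval x}.ncard = N)
    (hp : ∀ t ∈ T, ∀ x, A.eval x = t * D.eval x → p.eval x = 0)
    (hdeg : p.natDegree < T.card * N) : p = 0 := by
  classical
  have hpos : 0 < N := Nat.pos_of_mul_pos_left (Nat.zero_lt_of_lt hdeg)
  have hfin (t : F) (ht : t ∈ T) : {x | A.eval x = t * D.eval x}.Finite :=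
    Set.finite_of_ncard_pos (hN t ht ▸ hpos)
  refine eq_zero_of_natDegree_lt_card_of_eval_eq_zero' p
    (T.attach.biUnion fun t => (hfin t t.2).toFinset) ?_ ?_
  · simp only [Finset.mem_biUnion, Finset.mem_attach, true_and, Set.Finite.mem_toFinset,
      Set.mem_ofPred_eq, forall_exists_index]
    exact fun x t => hp t t.2 x
  · rw [Finset.card_biUnion, Finset.sum_congr rfl fun (t : T) _ =>
      (Set.ncard_eq_toFinset_card _ (hfin t t.2)).symm.trans (hN t t.2), Finset.sum_const,
      Finset.card_attach, smul_eq_mul]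
    · exact hdeg
    · refine fun t _ t' _ htt' => Finset.disjoint_left.mpr fun x hx hx' => htt' (Subtype.ext ?_)
      rw [Set.Finite.mem_toFinset, Set.mem_ofPred_eq] at hx hx'
      exact mul_right_cancel₀ (eval_ne_zero_of_isCoprime hAD hx) (hx.symm.trans hx')

variable [IsAlgClosed F] [CharZero F]

lemma aeval_homogenize_ne_zero (hAD : IsCoprime A D) (hpos : 0 < max A.natDegree D.natDegree)
    (hk : H.natDegree ≤ k) (hH : H ≠ 0) : MvPolynomial.aeval ![A, D] (H.homogenize k) ≠ 0 := by
  have : Infinite F := IsAlgClosed.instInfinite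
  intro h0
  obtain ⟨t, hcard, ht⟩ :=
    ((eventually_ncard_fiber hAD hpos).and (eventually_eval_ne_zero hH)).exists
  obtain ⟨x, hx⟩ := Set.nonempty_of_ncard_ne_zero (hcard ▸ hpos.ne')
  have heval := eval_aeval_homogenize hAD hk hx
  rw [h0, eval_zero] at heval
  exact mul_ne_zero ht (pow_ne_zero k (eval_ne_zero_of_isCoprime hAD hx)) heval.symm

/- With `N = max (deg A) (deg D)` and `k = max (deg p) (deg r)`, a fraction `H₁ / H₂` of degree `k`
interpolating `v` at `2 * k + 1` values makes `r * H₁(A / D) - p * H₂(A / D)` vanish at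
`(2 * k + 1) * N` points, more than its degree `k + k * N` allows. -/
lemma exists_eq_comp_fraction {p r : F[X]} (hAD : IsCoprime A D)
    (hpos : 0 < max A.natDegree D.natDegree) (hr : r ≠ 0) {v : F → F}
    (hv : ∀ᶠ t in cofinite, ∀ x, A.eval x = t * D.eval x → p.eval x = v t * r.eval x) :
    ∃ H₁ H₂ : F[X], H₂ ≠ 0 ∧ ∀ x t, A.eval x = t * D.eval x →
      r.eval x * H₁.eval t = p.eval x * H₂.eval t := by
  set N := max A.natDegree D.natDegree with hN
  set k := max p.natDegree r.natDegree with hk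
  have : Infinite F := IsAlgClosed.instInfinite
  obtain ⟨T, hT, hTcard⟩ := (frequently_cofinite_iff_infinite.mp
    ((eventually_ncard_fiber hAD hpos).and hv).frequently).exists_subset_card_eq (2 * k + 1)
  obtain ⟨H₁, H₂, hne, hH₁, hH₂, hH⟩ := exists_interpolation k T hTcard.le v
  have heq : r * MvPolynomial.aeval ![A, D] (H₁.homogenize k) -
      p * MvPolynomial.aeval ![A, D] (H₂.homogenize k) = 0 := by
    refine eq_zero_of_eval_fibers_eq_zero hAD (fun t ht => (hT ht).1) (fun t ht x hx => ?_) ?_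
    · rw [eval_sub, eval_mul, eval_mul, eval_aeval_homogenize hAD hH₁ hx,
        eval_aeval_homogenize hAD hH₂ hx, (hT ht).2 x hx, hH t ht]
      ring
    · have h₁ := natDegree_aeval_homogenize_le A D H₁ k
      have h₂ := natDegree_aeval_homogenize_le A D H₂ k
      have hle := natDegree_sub_le_of_le
        (natDegree_mul_le_of_le (le_max_right p.natDegree r.natDegree) h₁)
        (natDegree_mul_le_of_le (le_max_left p.natDegree r.natDegree) h₂)
      rw [← hN, ← hk, max_self] at hle
      rw [hTcard]
      nlinarith
  refine ⟨H₁, H₂, ?_, fun x t hx => ?_⟩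
  · rintro rfl
    rw [homogenize_zero, map_zero, mul_zero, sub_zero] at heq
    exact (mul_ne_zero hr (aeval_homogenize_ne_zero hAD hpos hH₁ (by simpa using hne))) heq
  · have heval := congrArg (Polynomial.eval x) heq
    rw [eval_sub, eval_mul, eval_mul, eval_aeval_homogenize hAD hH₁ hx,
      eval_aeval_homogenize hAD hH₂ hx, eval_zero] at heval
    apply mul_left_cancel₀ (pow_ne_zero k (eval_ne_zero_of_isCoprime hAD hx))
    linear_combination heval

end Interpolation

section Dual

variable {Ω : Type*} [Field Ω] [IsAlgClosed Ω] [CharZero Ω] [DecidableEq Ω]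
  {E₁ E₂ : WeierstrassCurve Ω} [E₁.IsElliptic] [E₂.IsElliptic] {φ : Pt E₁ →+ Pt E₂}

lemma IsRat.of_comp_of_even (hφ : IsIsogeny Ω φ) {h : Pt E₂ → Ω} (heven : ∀ Q, h (-Q) = h Q)
    (hr : IsRat fun P => h (φ P)) : IsRat h := by
  obtain ⟨A, D, hAD⟩ := hφ.isRatHom.exists_isFractionOfX
  obtain ⟨p, r, hpr⟩ := hr.exists_isFractionOfX (.of_forall fun P => by rw [map_neg, heven])
  choose Q hQ0 hQ using exists_xc_eq (E := E₂)
  have hgood := hpr.eventually_eq.and (eventually_map_ne hφ.finite_ker 0)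
  have hconst : ∀ᶠ t in cofinite, ∀ x, A.eval x = t * D.eval x →
      p.eval x = h (Q t) * r.eval x := by
    filter_upwards [hAD.eventually_fiber_iff, eventually_forall_fiber (fun P => xc (φ P)) hgood]
      with t hiff ht x hx
    obtain ⟨P, -, rfl⟩ := exists_xc_eq (E := E₁) x
    have hP := (hiff P).mpr hx
    obtain ⟨hfrac, h0⟩ := ht P hP
    rw [← hfrac]
    rcases Pt.eq_or_eq_neg h0 (hQ0 t) (hP.trans (hQ t).symm) with e | e
    · rw [e]
    · rw [e, heven]
  obtain ⟨H₁, H₂, hH₂, hcomp⟩ := exists_eq_comp_fraction hAD.isCoprime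
    (hAD.max_natDegree_pos_of_finite_ker hφ.finite_ker) hpr.ne_zero hconst
  refine ⟨H₁, 0, H₂, hH₂, ?_⟩
  filter_upwards [eventually_forall_fiber φ (hAD.eventually_eq.and
    (hpr.eventually_eq.and (eventually_eval_xc_ne_zero hpr.ne_zero))),
    eventually_eval_xc_ne_zero hH₂] with Q hfiber hQ
  obtain ⟨P, rfl⟩ := hφ.surjective Q
  obtain ⟨hA, hp, hr⟩ := hfiber P rfl
  rw [eval_zero, zero_mul, add_zero, eq_div_iff hQ]
  apply mul_left_cancel₀ hr
  linear_combination H₂.eval (xc (φ P)) * hp - hcomp _ _ hA.symm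

/- Every function is `(h₁ + h₂ * Y) / 2` with `h₁`, `h₂` even and `Y = 2 * y + a₁ * x + a₃` odd. -/
lemma IsRat.of_comp (hφ : IsIsogeny Ω φ) {h : Pt E₂ → Ω} (hr : IsRat fun P => h (φ P)) :
    IsRat h := by
  set Y : Pt E₂ → Ω := fun Q => 2 * yc Q + E₂.a₁ * xc Q + E₂.a₃ with hY
  have hYrat : IsRat Y :=
    ((isRat_yc.const_mul 2).add (isRat_xc.const_mul E₂.a₁)).add (IsRat.const E₂.a₃)
  have hneg : IsRat fun P => h (-φ P) := by simpa only [map_neg] using hr.comp_neg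
  have hsum : IsRat fun Q => h Q + h (-Q) :=
    IsRat.of_comp_of_even hφ (fun Q => by rw [neg_neg, add_comm]) (hr.add hneg)
  have hdiff : IsRat fun Q => (h Q - h (-Q)) / Y Q := by
    refine IsRat.of_comp_of_even hφ (fun Q => ?_)
      ((hr.sub hneg).div (hYrat.comp hφ.isRatHom hφ.finite_ker))
    by_cases hQ : Q = 0
    · rw [hQ, neg_zero, neg_zero]
    · have hYneg : Y (-Q) = -Y Q := by
        simp only [hY, yc_neg hQ, xc_neg]
        ring
      rw [neg_neg, hYneg, div_neg, ← neg_div, neg_sub]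
  refine ((hsum.add (hdiff.mul hYrat)).const_mul 2⁻¹).congr ?_
  filter_upwards [eventually_map_ne finite_ker_mulHom_two 0, eventually_cofinite_ne 0]
    with Q hQ hQ0
  have hYQ : Y Q ≠ 0 := mt (Pt.two_nsmul_eq_zero_iff hQ0).mpr hQ
  field

lemma IsIsogeny.exists_dual (hφ : IsIsogeny Ω φ) : ∃ ψ : Pt E₂ →+ Pt E₁, IsIsogeny Ω ψ ∧
    Nat.card ψ.ker = Nat.card φ.ker ∧ ψ.comp φ = mulHom E₁ (Nat.card φ.ker) := by
  have := hφ.finite_ker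
  set n := Nat.card φ.ker
  have hn : n ≠ 0 := Nat.card_pos.ne'
  have hmul : IsIsogeny Ω (mulHom E₁ n) := isIsogeny_mulHom hn
  let ψ : Pt E₂ →+ Pt E₁ := φ.liftOfSurjective hφ.surjective ⟨mulHom E₁ n, le_torsion_card φ.ker⟩
  have hψ : ψ.comp φ = mulHom E₁ n := AddMonoidHom.liftOfRightInverse_comp _ _ _ _
  have hψφ (P : Pt E₁) : ψ (φ P) = mulHom E₁ n P := DFunLike.congr_fun hψ P
  have hcard : Nat.card ψ.ker = n := Nat.eq_of_mul_eq_mul_left Nat.card_pos <|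
    calc n * Nat.card ψ.ker = Nat.card (ψ.comp φ).ker := (card_ker_comp hφ.surjective).symm
      _ = n ^ 2 := by rw [hψ]; exact card_torsion hn
      _ = n * n := pow_two n
  refine ⟨ψ, IsRatHom.isIsogeny ⟨?_, ?_⟩ ?_, hcard, hψ⟩
  · exact IsRat.of_comp hφ (by simpa only [hψφ] using hmul.isRatHom.1)
  · exact IsRat.of_comp hφ (by simpa only [hψφ] using hmul.isRatHom.2)
  · exact Nat.finite_of_card_ne_zero (hcard ▸ hn)

end Dual

/-! ### Isogenies between curves without complex multiplication -/

section NoCM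

variable {Ω : Type*} [Field Ω] [IsAlgClosed Ω] [DecidableEq Ω] {E E' : WeierstrassCurve Ω}
  [E.IsElliptic]

lemma IsIsogeny.exists_eq_units_smul_mulHom (hE : ¬ HasCM E) {α : Pt E →+ Pt E}
    (hα : IsIsogeny Ω α) : ∃ s : ℤˣ, ∃ n : ℕ, n ≠ 0 ∧ α = s • mulHom E n := by
  have hscalar : ∃ n : ℤ, α = n • AddMonoidHom.id (Pt E) := by
    by_contra! hne
    exact hE ⟨α, hα, hne⟩
  obtain ⟨n, rfl⟩ := hscalar
  have hn : n ≠ 0 := by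
    rintro rfl
    have := infinite_pt (E := E)
    obtain ⟨P, hP⟩ := exists_ne (0 : Pt E)
    obtain ⟨Q, hQ⟩ := hα.surjective P
    exact hP (hQ.symm.trans (zero_smul ℤ Q))
  obtain ⟨s, hs⟩ : ∃ s : ℤˣ, n = s * n.natAbs := by
    rcases n.natAbs_eq with h | h
    · exact ⟨1, by simpa using h⟩
    · exact ⟨-1, by simpa using h⟩
  refine ⟨s, n.natAbs, Int.natAbs_ne_zero.mpr hn, DFunLike.ext _ _ fun P => ?_⟩
  change n • P = (s : ℤ) • n.natAbs • P
  rw [← natCast_zsmul, ← mul_smul, ← hs]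

variable [CharZero Ω]

lemma eq_of_nsmul_eq_nsmul {B : Type*} [AddCommGroup B] {n : ℕ} (hn : n ≠ 0) {α β : Pt E →+ B}
    (h : n • α = n • β) : α = β := by
  refine DFunLike.ext _ _ fun P => ?_
  obtain ⟨Q, rfl⟩ := (isIsogeny_mulHom (E := E) hn).surjective P
  exact (map_nsmul α n Q).trans ((DFunLike.congr_fun h Q).trans (map_nsmul β n Q).symm)

lemma dvd_of_torsion_le {m n : ℕ} (hm : m ≠ 0) (h : torsion (Pt E) m ≤ torsion (Pt E) n) :
    m ∣ n := by
  have hgcd : m ^ 2 = (m.gcd n) ^ 2 := by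
    rw [← card_torsion (E := E) hm, ← card_torsion (E := E) (Nat.gcd_ne_zero_left hm),
      ← torsion_inf_torsion, inf_eq_left.mpr h]
  exact Nat.gcd_eq_left_iff_dvd.mp (Nat.pow_left_injective two_ne_zero hgcd.symm)

lemma exists_comp_eq_units_smul_mulHom (hE : ¬ HasCM E) {μ : Pt E →+ Pt E'} {ν : Pt E' →+ Pt E}
    (hμ : IsIsogeny Ω μ) (hν : IsIsogeny Ω ν) (hcard : Nat.card ν.ker = Nat.card μ.ker) :
    ∃ s : ℤˣ, ν.comp μ = s • mulHom E (Nat.card μ.ker) := by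
  obtain ⟨s, n, hn, h⟩ := (hν.comp hμ).exists_eq_units_smul_mulHom hE
  have hsq : n ^ 2 = Nat.card μ.ker ^ 2 :=
    calc n ^ 2 = Nat.card (mulHom E n).ker := (card_torsion hn).symm
      _ = Nat.card (ν.comp μ).ker := by rw [h, ker_units_smul]
      _ = Nat.card μ.ker ^ 2 := by rw [card_ker_comp hμ.surjective, hcard, pow_two]
  exact ⟨s, by rw [h, Nat.pow_left_injective two_ne_zero hsq]⟩

variable [E'.IsElliptic]

lemma IsIsogeny.exists_eq_units_smul (hE : ¬ HasCM E) {μ μ' : Pt E →+ Pt E'}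
    (hμ : IsIsogeny Ω μ) (hμ' : IsIsogeny Ω μ') (hcard : Nat.card μ'.ker = Nat.card μ.ker) :
    ∃ s : ℤˣ, μ' = s • μ := by
  obtain ⟨ν, hν, hνcard, hνμ⟩ := hμ.exists_dual
  have hμν := comp_eq_nsmul_of_comp_eq_nsmul hμ.surjective hνμ
  obtain ⟨s, hs⟩ := exists_comp_eq_units_smul_mulHom hE hμ' hν (hνcard.trans hcard.symm)
  have := hμ.finite_ker
  refine ⟨s, eq_of_nsmul_eq_nsmul (n := Nat.card μ.ker) Nat.card_pos.ne' ?_⟩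
  calc Nat.card μ.ker • μ' = (μ.comp ν).comp μ' := by rw [hμν]; rfl
    _ = μ.comp (ν.comp μ') := AddMonoidHom.comp_assoc _ _ _
    _ = Nat.card μ.ker • s • μ := by
      rw [hs, hcard]
      ext P
      exact (map_zsmul μ (s : ℤ) _).trans ((congrArg _ (map_nsmul μ _ P)).trans (smul_comm _ _ _))

lemma not_hasCM_of_isIsogeny (hE : ¬ HasCM E) {φ : Pt E →+ Pt E'} (hφ : IsIsogeny Ω φ) :
    ¬ HasCM E' := by
  rintro ⟨α, hα, hne⟩
  have := hφ.finite_ker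
  set m := Nat.card φ.ker
  have hm : m ≠ 0 := Nat.card_pos.ne'
  obtain ⟨ψ, hψ, -, hψφ⟩ := hφ.exists_dual
  have hφψ (Q : Pt E') : φ (ψ Q) = m • Q :=
    DFunLike.congr_fun (comp_eq_nsmul_of_comp_eq_nsmul hφ.surjective hψφ) Q
  obtain ⟨s, n, -, hn⟩ := (hψ.comp (hα.comp hφ)).exists_eq_units_smul_mulHom hE
  have hψαφ (P : Pt E) : ψ (α (φ P)) = s • n • P := DFunLike.congr_fun hn P
  have hmα : m • α = s • mulHom E' n := eq_of_nsmul_eq_nsmul hm <| DFunLike.ext _ _ fun Q => by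
    change m • m • α Q = m • (s : ℤ) • n • Q
    rw [← map_nsmul, ← hφψ Q, ← hφψ (α _), hψαφ]
    change φ ((s : ℤ) • _) = _
    rw [map_zsmul, map_nsmul, hφψ, smul_comm m, smul_comm m]
  obtain ⟨k, rfl⟩ : m ∣ n := by
    refine dvd_of_torsion_le (E := E') hm fun Q hQ => ?_
    rw [torsion, ← ker_units_smul (A := Pt E') s, ← hmα]
    exact (map_nsmul α m Q).symm.trans ((congrArg α hQ).trans (map_zero α))
  refine hne (s * k) (eq_of_nsmul_eq_nsmul hm (hmα.trans (DFunLike.ext _ _ fun Q => ?_)))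
  change (s : ℤ) • (m * k) • Q = m • ((s : ℤ) * k) • Q
  rw [mul_smul, mul_smul, natCast_zsmul, smul_comm (s : ℤ)]

end NoCM

/-! ### Conjugate curves and rational points on Atkin–Lehner quotients -/

section Conjugate

variable {Ω : Type*} [Field Ω] [DecidableEq Ω] {W W' W₁ W₂ W₁' W₂' : WeierstrassCurve Ω}
  {g : Ω ≃+* Ω}

/-- The isomorphism `conjPt g W`, `(x, y) ↦ (g x, g y)`, onto a curve `W'` that is only
propositionally equal to the conjugate `W^g`; so the conjugate of the base change of a curve can be
treated as a base change itself. -/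
def conjTo (g : Ω ≃+* Ω) (h : conj g W = W') : Pt W ≃+ Pt W' := h ▸ conjPt g W

lemma xc_conjTo (h : conj g W = W') (P : Pt W) : xc (conjTo g h P) = g (xc P) := by
  subst h
  rcases P with _ | ⟨x, y, hP⟩
  exacts [(map_zero g).symm, rfl]

lemma yc_conjTo (h : conj g W = W') (P : Pt W) : yc (conjTo g h P) = g (yc P) := by
  subst h
  rcases P with _ | ⟨x, y, hP⟩
  exacts [(map_zero g).symm, rfl]

/-- The conjugate `φ^g` of a homomorphism `φ`, between curves that are propositionally equal to the
conjugates. -/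
def conjHomTo (g : Ω ≃+* Ω) (h₁ : conj g W₁ = W₁') (h₂ : conj g W₂ = W₂')
    (φ : Pt W₁ →+ Pt W₂) : Pt W₁' →+ Pt W₂' :=
  (conjTo g h₂).toAddMonoidHom.comp (φ.comp (conjTo g h₁).symm.toAddMonoidHom)

lemma conjHomTo_conjTo (h₁ : conj g W₁ = W₁') (h₂ : conj g W₂ = W₂') (φ : Pt W₁ →+ Pt W₂)
    (P : Pt W₁) : conjHomTo g h₁ h₂ φ (conjTo g h₁ P) = conjTo g h₂ (φ P) :=
  congrArg (fun Q => conjTo g h₂ (φ Q)) ((conjTo g h₁).symm_apply_apply P)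

lemma ker_conjHomTo (h₁ : conj g W₁ = W₁') (h₂ : conj g W₂ = W₂') (φ : Pt W₁ →+ Pt W₂) :
    (conjHomTo g h₁ h₂ φ).ker = φ.ker.map (conjTo g h₁).toAddMonoidHom := by
  subst h₁ h₂
  exact conjHom_ker g φ

lemma card_ker_conjHomTo (h₁ : conj g W₁ = W₁') (h₂ : conj g W₂ = W₂') (φ : Pt W₁ →+ Pt W₂) :
    Nat.card (conjHomTo g h₁ h₂ φ).ker = Nat.card φ.ker := by
  rw [ker_conjHomTo]
  exact (Nat.card_congr ((conjTo g h₁).addSubgroupMap φ.ker).toEquiv).symm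

lemma isIsogeny_conjHomTo (h₁ : conj g W₁ = W₁') (h₂ : conj g W₂ = W₂') {φ : Pt W₁ →+ Pt W₂}
    (hφ : IsIsogeny Ω φ) : IsIsogeny Ω (conjHomTo g h₁ h₂ φ) := by
  subst h₁ h₂
  exact hφ.conj g

lemma givenBy_conjHomTo (h₁ : conj g W₁ = W₁') (h₂ : conj g W₂ = W₂') {φ : Pt W₁ →+ Pt W₂}
    {u v w : Polynomial (Polynomial Ω)} (h : GivenBy φ u v w) :
    GivenBy (conjHomTo g h₁ h₂ φ) (u.map (mapRingHom (g : Ω →+* Ω)))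
      (v.map (mapRingHom (g : Ω →+* Ω))) (w.map (mapRingHom (g : Ω →+* Ω))) := by
  rw [givenBy_iff] at h ⊢
  filter_upwards [(conjTo g h₁).symm.injective.tendsto_cofinite.eventually h] with P hP
  obtain ⟨P, rfl⟩ := (conjTo g h₁).surjective P
  rw [AddEquiv.symm_apply_apply] at hP
  obtain ⟨hP0, hφP, hw, hx, hy⟩ := hP
  have hmap (p : Polynomial (Polynomial Ω)) :
      (p.map (mapRingHom (g : Ω →+* Ω))).evalEval (g (xc P)) (g (yc P)) =
        g (p.evalEval (xc P) (yc P)) :=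
    map_mapRingHom_evalEval (g : Ω →+* Ω) p _ _
  rw [conjHomTo_conjTo, xc_conjTo, yc_conjTo, xc_conjTo, yc_conjTo, hmap, hmap, hmap, hx, hy,
    ← map_div₀, ← map_div₀]
  exact ⟨(map_ne_zero_iff _ (conjTo g h₁).injective).mpr hP0,
    (map_ne_zero_iff _ (conjTo g h₂).injective).mpr hφP, (map_ne_zero g).mpr hw, rfl, rfl⟩

lemma conjHomTo_eq_self {k : Type*} [Field k] [Algebra k Ω] [Infinite (Pt W₁)]
    {φ : Pt W₁ →+ Pt W₂} (hφ : IsIsogeny k φ)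
    (hg : ∀ a : k, g (algebraMap k Ω a) = algebraMap k Ω a) (h₁ : conj g W₁ = W₁)
    (h₂ : conj g W₂ = W₂) : conjHomTo g h₁ h₂ φ = φ := by
  obtain ⟨u, v, w, h⟩ := hφ.rational
  have hcoeff (p : Polynomial (Polynomial k)) :
      (p.map (mapRingHom (algebraMap k Ω))).map (mapRingHom (g : Ω →+* Ω)) =
        p.map (mapRingHom (algebraMap k Ω)) := by
    rw [Polynomial.map_map, mapRingHom_comp, RingHom.ext (f := (g : Ω →+* Ω).comp _) hg]
  have hconj := givenBy_conjHomTo h₁ h₂ h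
  rw [hcoeff, hcoeff, hcoeff] at hconj
  exact hconj.eq h

lemma CyclicPair.conj_eq {n : ℕ} (p : CyclicPair Ω n) (hg : QCurve.conj g p.E = W') :
    ∃ (h₁ : W'.IsElliptic) (h₂ : IsAddCyclic (p.C.map (conjTo g hg).toAddMonoidHom))
      (h₃ : Nat.card (p.C.map (conjTo g hg).toAddMonoidHom) = n),
      p.conj g = ⟨W', h₁, p.C.map (conjTo g hg).toAddMonoidHom, h₂, h₃⟩ := by
  subst hg
  exact ⟨(p.conj g).elliptic, (p.conj g).cyclic, (p.conj g).card, rfl⟩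

end Conjugate

section Corresponds

variable {Ω : Type*} [Field Ω] [DecidableEq Ω] [Algebra ℚ Ω] {W W' : WeierstrassCurve Ω}
  [W.IsElliptic] {C : AddSubgroup (Pt W)}

lemma corresponds_of_forall_conj {n d : ℕ} (hC : IsAddCyclic C) (hn : Nat.card C = n)
    (H : ∀ g : Ω ≃ₐ[ℚ] Ω,
      (∃ h : conj (g : Ω ≃+* Ω) W = W, C.map (conjTo (g : Ω ≃+* Ω) h).toAddMonoidHom = C) ∨
      ∃ (W' : WeierstrassCurve Ω) (h : conj (g : Ω ≃+* Ω) W = W'),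
        IsQuotientBy d (n / d) C (C.map (conjTo (g : Ω ≃+* Ω) h).toAddMonoidHom)) :
    Corresponds W n d := by
  let p : CyclicPair Ω n := ⟨W, inferInstance, C, hC, hn⟩
  refine ⟨Y0Quot.mk d (Quotient.mk _ p), fun g => ?_, Quotient.mk _ p, rfl, rfl⟩
  rcases H g with ⟨h, hCg⟩ | ⟨W', h, hquot⟩
  · obtain ⟨_, _, _, hconj⟩ := p.conj_eq h
    have hp : p.conj (g : Ω ≃+* Ω) = p := by
      rw [hconj]
      simp only [p, hCg]
    exact congrArg (fun q => Y0Quot.mk d (Quotient.mk _ q)) hp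
  · subst h
    exact (Quot.sound ⟨p, p.conj (g : Ω ≃+* Ω), rfl, rfl, hquot⟩).symm

lemma corresponds_of_forall_conj_sup {d m : ℕ} {μ : Pt W →+ Pt W'} (hμ : IsIsogeny Ω μ)
    (hμd : HasCyclicKernel μ d) (hmd : m.Coprime d) (hC : IsAddCyclic C) (hCm : Nat.card C = m)
    (H : ∀ g : Ω ≃ₐ[ℚ] Ω,
      (∃ h : conj (g : Ω ≃+* Ω) W = W, μ.ker.map (conjTo (g : Ω ≃+* Ω) h).toAddMonoidHom = μ.ker ∧
        C.map (conjTo (g : Ω ≃+* Ω) h).toAddMonoidHom = C) ∨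
      ∃ h : conj (g : Ω ≃+* Ω) W = W',
        μ.ker.map (conjTo (g : Ω ≃+* Ω) h).toAddMonoidHom = (torsion (Pt W) d).map μ ∧
        C.map (conjTo (g : Ω ≃+* Ω) h).toAddMonoidHom = C.map μ) :
    Corresponds W (d * m) d := by
  obtain ⟨hμcyc, rfl⟩ := hμd
  subst hCm
  have := hμ.finite_ker
  obtain ⟨hcyc, hcard⟩ := isAddCyclic_sup_and_card hμcyc hC hmd.symm
  have hμtor := le_torsion_card μ.ker
  have hCtor := le_torsion_card C
  refine corresponds_of_forall_conj hcyc hcard fun g => (H g).imp ?_ ?_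
  · rintro ⟨h, hker, hCg⟩
    exact ⟨h, by rw [AddSubgroup.map_sup, hker, hCg]⟩
  · rintro ⟨h, hker, hCg⟩
    refine ⟨W', h, μ, hμ, (sup_inf_torsion hmd.symm hμtor hCtor).symm, ?_⟩
    rw [Nat.mul_div_cancel_left _ Nat.card_pos, AddSubgroup.map_sup, hker, hCg,
      sup_comm μ.ker C, sup_inf_torsion hmd hCtor hμtor]

end Corresponds

/-! ### Elliptic curves over a quadratic field -/

section Quadratic

variable {K : Type*} [Field K]

lemma conj_map {L : Type*} [Field L] {f f' : K →+* L} {g : L ≃+* L} (F : WeierstrassCurve K)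
    (h : ∀ a, g (f a) = f' a) : conj g (F.map f) = F.map f' := by
  ext <;> exact h _

variable [Algebra ℚ K]

/-- The automorphism `g` of the algebraic closure extends the automorphism `s` of `K`. For `s = 1`
it says that `g` fixes `K` pointwise. -/
def LiesOver (g : AlgebraicClosure K ≃+* AlgebraicClosure K) (s : K ≃ₐ[ℚ] K) : Prop :=
  ∀ a : K, g (algebraMap K _ a) = algebraMap K _ (s a)

variable {g : AlgebraicClosure K ≃+* AlgebraicClosure K} {σ : K ≃ₐ[ℚ] K}

lemma conj_geom_of_liesOver_one (F : WeierstrassCurve K) (hg : LiesOver g 1) :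
    conj g (geom F) = geom F :=
  conj_map F hg

lemma conj_geom_of_liesOver (F : WeierstrassCurve K) (hg : LiesOver g σ) :
    conj g (geom F) = geom (F.map (σ : K →+* K)) :=
  (conj_map (f' := (algebraMap K (AlgebraicClosure K)).comp (σ : K →+* K)) F hg).trans
    (F.map_map _ _).symm

lemma conj_geom_map_of_liesOver (hσσ : ∀ a, σ (σ a) = a) (F : WeierstrassCurve K)
    (hg : LiesOver g σ) : conj g (geom (F.map (σ : K →+* K))) = geom F := by
  rw [geom, F.map_map]
  exact conj_map F fun a => (hg (σ a)).trans (by rw [hσσ])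

section NumberField

variable {K : Type*} [Field K] [NumberField K] {σ : K ≃ₐ[ℚ] K}

lemma eq_one_or_eq_of_finrank_eq_two (hK : Module.finrank ℚ K = 2) (hσ : σ ≠ 1) (s : K ≃ₐ[ℚ] K) :
    s = 1 ∨ s = σ := by
  have : Algebra.IsQuadraticExtension ℚ K := ⟨hK⟩
  have hcard : Nat.card (K ≃ₐ[ℚ] K) = 2 := (IsGalois.card_aut_eq_finrank ℚ K).trans hK
  obtain ⟨t, -, ht⟩ := (Nat.card_eq_two_iff' (1 : K ≃ₐ[ℚ] K)).mp hcard
  exact or_iff_not_imp_left.mpr fun hs => (ht s hs).trans (ht σ hσ).symm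

lemma apply_apply_of_finrank_eq_two (hK : Module.finrank ℚ K = 2) (hσ : σ ≠ 1) (a : K) :
    σ (σ a) = a := by
  rcases eq_one_or_eq_of_finrank_eq_two hK hσ (σ * σ) with h | h
  · exact DFunLike.congr_fun h a
  · exact absurd (mul_eq_left.mp h) hσ

lemma liesOver_one_or_liesOver (hK : Module.finrank ℚ K = 2) (hσ : σ ≠ 1)
    (g : AlgebraicClosure K ≃ₐ[ℚ] AlgebraicClosure K) :
    LiesOver (g : AlgebraicClosure K ≃+* AlgebraicClosure K) 1 ∨
      LiesOver (g : AlgebraicClosure K ≃+* AlgebraicClosure K) σ := by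
  have : Algebra.IsQuadraticExtension ℚ K := ⟨hK⟩
  have hg : LiesOver (g : AlgebraicClosure K ≃+* AlgebraicClosure K) (g.restrictNormal K) :=
    fun a => (g.restrictNormal_commutes K a).symm
  rcases eq_one_or_eq_of_finrank_eq_two hK hσ (g.restrictNormal K) with h | h <;> rw [h] at hg
  exacts [.inl hg, .inr hg]

variable [DecidableEq (AlgebraicClosure K)] {E E' : WeierstrassCurve K} [E.IsElliptic]

lemma ker_map_conjTo_of_isIsogeny {φ : Pt (geom E) →+ Pt (geom E')} (hφ : IsIsogeny K φ)
    {g : AlgebraicClosure K ≃+* AlgebraicClosure K} (hg : LiesOver g 1) :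
    φ.ker.map (conjTo g (conj_geom_of_liesOver_one E hg)).toAddMonoidHom = φ.ker := by
  rw [← ker_conjHomTo _ (conj_geom_of_liesOver_one E' hg) φ, conjHomTo_eq_self hφ hg]

variable {d : ℕ} {μ : Pt (geom E) →+ Pt (geom (E.map (σ : K →+* K)))}

lemma corresponds_of_isIsogeny_conj {m : ℕ} (hK : Module.finrank ℚ K = 2)
    (hCM : ¬ HasCM (geom E)) (hσ : σ ≠ 1) (hμ : IsIsogeny (AlgebraicClosure K) μ)
    (hμd : HasCyclicKernel μ d) (hmd : m.Coprime d) {C : AddSubgroup (Pt (geom E))}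
    (hC : IsAddCyclic C) (hCm : Nat.card C = m)
    (hfix : ∀ (g : AlgebraicClosure K ≃+* AlgebraicClosure K) (hg : LiesOver g 1),
      C.map (conjTo g (conj_geom_of_liesOver_one E hg)).toAddMonoidHom = C)
    (hlift : ∀ (g : AlgebraicClosure K ≃+* AlgebraicClosure K) (hg : LiesOver g σ),
      C.map (conjTo g (conj_geom_of_liesOver E hg)).toAddMonoidHom = C.map μ) :
    Corresponds (geom E) (d * m) d := by
  refine corresponds_of_forall_conj_sup hμ hμd hmd hC hCm fun g =>
    (liesOver_one_or_liesOver hK hσ g).imp (fun hg => ?_) fun hg => ?_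
  · refine ⟨conj_geom_of_liesOver_one E hg, ?_, hfix _ hg⟩
    have hE' := conj_geom_of_liesOver_one (E.map (σ : K →+* K)) hg
    obtain ⟨s, hs⟩ := hμ.exists_eq_units_smul hCM
      (isIsogeny_conjHomTo (conj_geom_of_liesOver_one E hg) hE' hμ) (card_ker_conjHomTo _ hE' μ)
    rw [← ker_conjHomTo _ hE' μ, hs, ker_units_smul]
  · refine ⟨conj_geom_of_liesOver E hg, ?_, hlift _ hg⟩
    have hE' := conj_geom_map_of_liesOver (apply_apply_of_finrank_eq_two hK hσ) E hg
    obtain ⟨s, hs⟩ := exists_comp_eq_units_smul_mulHom hCM hμ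
      (isIsogeny_conjHomTo (conj_geom_of_liesOver E hg) hE' hμ) (card_ker_conjHomTo _ hE' μ)
    rw [← ker_conjHomTo _ hE' μ, ker_eq_map_torsion_of_comp_eq hμ.surjective hs, hμd.2]

lemma corresponds_of_isQCurveOfDegree (hK : Module.finrank ℚ K = 2) (hCM : ¬ HasCM (geom E))
    (hE : IsQCurveOfDegree E d) : Corresponds (geom E) d d := by
  obtain ⟨σ, hσ, μ, hμ, hμd⟩ := hE
  simpa only [mul_one] using corresponds_of_isIsogeny_conj hK hCM hσ hμ hμd d.coprime_one_left
    (C := ⊥) inferInstance AddSubgroup.card_bot (fun _ _ => AddSubgroup.map_bot _)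
    fun _ _ => by rw [AddSubgroup.map_bot, AddSubgroup.map_bot]

lemma isQCurveOfDegree_of_map_ker_ne [E'.IsElliptic] {m : ℕ} (hσ : σ ≠ 1)
    (hμ : IsIsogeny (AlgebraicClosure K) μ) (hμd : HasCyclicKernel μ d) (hm : m.Prime)
    (hmd : m.Coprime d) {φ : Pt (geom E) →+ Pt (geom E')} (hφ : IsIsogeny (AlgebraicClosure K) φ)
    (hφm : Nat.card φ.ker = m) {ρ : AlgebraicClosure K ≃+* AlgebraicClosure K}
    (hρ : LiesOver ρ σ)
    (hne : φ.ker.map (conjTo ρ (conj_geom_of_liesOver E hρ)).toAddMonoidHom ≠ φ.ker.map μ) :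
    IsQCurveOfDegree E' (d * m ^ 2) := by
  have hE := conj_geom_of_liesOver E hρ
  have hE' := conj_geom_of_liesOver E' hρ
  have := hμ.finite_ker
  have hd : d ≠ 0 := hμd.2 ▸ Nat.card_pos.ne'
  obtain ⟨ψ, hψ, hψcard, hψφ⟩ := hφ.exists_dual
  rw [hφm] at hψcard hψφ
  refine ⟨σ, hσ, (conjHomTo ρ hE hE' φ).comp (μ.comp ψ),
    (isIsogeny_conjHomTo hE hE' hφ).comp (hμ.comp hψ),
    hasCyclicKernel_comp hm hmd hd hψ.surjective hμ.surjective hψφ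
      (comp_eq_nsmul_of_comp_eq_nsmul hφ.surjective hψφ) hφm hψcard hμd
      ((card_ker_conjHomTo hE hE' φ).trans hφm) ?_⟩
  rw [ker_conjHomTo]
  exact hne.symm

end NumberField

end Quadratic

end QCurve

theorem mainTheorem5 (K : Type*) [Field K] [NumberField K] (hK : Module.finrank ℚ K = 2)
    [DecidableEq (AlgebraicClosure K)] (E : WeierstrassCurve K) [E.IsElliptic]
    (d m : ℕ) (hm : m.Prime) (hmd : m.Coprime d)
    (hCM : ¬ QCurve.HasCM (QCurve.geom E))
    (hE : QCurve.IsQCurveOfDegree E d)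
    (hiso : QCurve.HasIsogenyOfDegree E m) :
    QCurve.Corresponds (QCurve.geom E) (d * m) d ∨
      ∃ (E' : WeierstrassCurve K) (_ : E'.IsElliptic), QCurve.IsogenousOver E E' ∧
        QCurve.Corresponds (QCurve.geom E') (d * m ^ 2) (d * m ^ 2) := by
  obtain ⟨σ, hσ, μ, hμ, hμd⟩ := hE
  obtain ⟨E', hE', φ, hφK, hφcyc, hφm⟩ := hiso
  have hφ := hφK.of_subfield
  by_cases hlift : ∀ (g : AlgebraicClosure K ≃+* AlgebraicClosure K) (hg : QCurve.LiesOver g σ),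
      φ.ker.map (QCurve.conjTo g (QCurve.conj_geom_of_liesOver E hg)).toAddMonoidHom = φ.ker.map μ
  · exact .inl <| QCurve.corresponds_of_isIsogeny_conj hK hCM hσ hμ hμd hmd hφcyc hφm
      (fun _ hg => QCurve.ker_map_conjTo_of_isIsogeny hφK hg) hlift
  · push Not at hlift
    obtain ⟨ρ, hρ, hne⟩ := hlift
    have hE'deg : QCurve.IsQCurveOfDegree E' (d * m ^ 2) :=
      QCurve.isQCurveOfDegree_of_map_ker_ne hσ hμ hμd hm hmd hφ hφm hρ hne
    exact .inr ⟨E', hE', ⟨φ, hφK⟩, QCurve.corresponds_of_isQCurveOfDegree hK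
      (QCurve.not_hasCM_of_isIsogeny hCM hφ) hE'deg⟩
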